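/- Let $d\ge 1$, let $K\subset\mathbb R^d$ be a bounded open convex set that is symmetric about the origin and contains it, let $C\subset\mathbb R^d$ be a non-empty open convex cone, let $\mu$ be Lebesgue measure, and let $p\in(d,\infty]$, $p'=p/(p-1)$ ($p'=1$ for $p=\infty$). Write $|x|_K=\inf\{\lambda>0: x\in\lambda K\}$ and $|z|_{K^\circ}=\sup\{(x,z):|x|_K\le 1\}$. Let $W^{1,p}(C)$ be the set of locally integrable functions $f:C\to\mathbb R$ all of whose first order distributional derivatives belong to $L_p(C)$, and let $\nabla f$ be the distributional gradient. For locally integrable $f$ on $C$ and $h>0$ put $$\rfloor f\lceil_h=\sup_{x\in C}\Bigl|\int_{hK\cap C}f(x+u)\,du\Bigr|,\qquad \rfloor f\lceil=\sup_{h>0}\rfloor f\lceil_h .$$ For $0<u<h$ put $g_h(u)=\frac{1}{d\,\mu(K\cap C)}\bigl(\frac1{u^{d-1}}-\frac{u}{h^d}\bigr)$, and define $f_{e,h}:C\to\mathbb R$ by $$f_{e,h}(y)=\int_{|y|_K}^h g_h^{p'-1}(u)\,du\ \text{ for } y\in hK\cap C,\qquad f_{e,h}(y)=0\ \text{ for }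 y\in C\setminus hK .$$ Finally let, with $B$ the Euler Beta function, $$A=A(d,p)=\frac1d\,B\Bigl(1-\frac{(d-1)p'}{d},\,p'+1\Bigr)^{1/p'},\quad \alpha=\frac{pd}{p+(p-1)d},\quad a(d,p)=\Bigl(\frac{(p-d)A}{pd}\Bigr)^{\alpha}\Bigl(\frac{pd}{p-d}+1\Bigr),$$ where for $p=\infty$ the last two are read as their limits $\alpha=\frac d{d+1}$ and $a(d,\infty)=(A/d)^{\alpha}(d+1)$. (i) Let $h>0$. If $f\in W^{1,p}(C)$ and $\rfloor f\lceil_h<\infty$, then $f\in L_\infty(C)$ and $$\|f\|_{L_\infty(C)}\le \bigl\|g_h(|\cdot|_K)\bigr\|_{L_{p'}(hK\cap C)}\,\bigl\||\nabla f|_{K^\circ}\bigr\|_{L_p(C)}+\mu(K\cap C)^{-1}h^{-d}\,\rfloor f\lceil_h .\qquad(1)$$ Inequality (1) is sharp: $f_{e,h}$ belongs to this class of functions and turns (1) into an equality, and neither of the two constants in (1) can be decreased. (ii) If $f\in W^{1,p}(C)$ and $\rfloor f\lceil<\infty$, then $$\|f\|_{L_\infty(C)}\le a(d,p)\,\mu(K\cap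 C)^{-\alpha/d}\,\rfloor f\lceil^{\,1-\alpha}\,\bigl\||\nabla f|_{K^\circ}\bigr\|_{L_p(C)}^{\alpha}.\qquad(2)$$ Inequality (2) is sharp: for every $h>0$ the function $f_{e,h}$ belongs to this class of functions and turns (2) into an equality, and the constant in (2) cannot be decreased. (iii) If $f\in W^{1,p}(C)\cap L_1(C)$, then (1), for every $h>0$, and (2) hold with $\|f\|_{L_1(C)}$ in place of $\rfloor f\lceil_h$ and $\rfloor f\lceil$ respectively. The resulting inequalities are sharp in the same sense: for every $h>0$ the function $f_{e,h}$ belongs to $W^{1,p}(C)\cap L_1(C)$ and turns both into equalities, and their constants cannot be decreased on this class. -/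

import Mathlib

open MeasureTheory Set
open scoped ENNReal Pointwise

noncomputable section

namespace NagyInequality

/-- `d`-dimensional Euclidean space. -/
abbrev E (d : ℕ) : Type := EuclideanSpace ℝ (Fin d)

/-- The dual norm `|z|_{K°} = sup {(x, z) : |x|_K ≤ 1}`, where `|x|_K = gauge K x`. -/
def dualNorm {d : ℕ} (K : Set (E d)) (z : E d) : ℝ :=
  sSup ((fun x : E d => inner ℝ x z) '' {x | gauge K x ≤ 1})

/-- `G` is a distributional gradient of `f` on the open set `Q` that is represented by locally
integrable functions: `∫_Q f ∂ᵢφ = - ∫_Q Gᵢ φ` for all test functions `φ` on `Q`. -/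
def IsWeakGradient {d : ℕ} (Q : Set (E d)) (f : E d → ℝ) (G : E d → E d) : Prop :=
  (∀ i, LocallyIntegrableOn (fun x => G x i) Q volume) ∧
  ∀ φ : E d → ℝ, ContDiff ℝ (⊤ : ℕ∞) φ → HasCompactSupport φ → tsupport φ ⊆ Q → ∀ i,
    ∫ x in Q, f x * fderiv ℝ φ x (EuclideanSpace.single i 1) = - ∫ x in Q, G x i * φ x

open Classical in
/-- The distributional gradient of `f` on `Q` (unique almost everywhere on `Q`), and `0` if it is
not represented by locally integrable functions. -/
def weakGradient {d : ℕ} (Q : Set (E d)) (f : E d → ℝ) : E d → E d :=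
  if h : ∃ G, IsWeakGradient Q f G then h.choose else 0

/-- `f ∈ W^{1,p}(Q)`: `f` is locally integrable on `Q` and all its first order distributional
derivatives belong to `L_p(Q)` (no integrability of `f` itself is required). -/
def MemW {d : ℕ} (Q : Set (E d)) (p : ℝ≥0∞) (f : E d → ℝ) : Prop :=
  LocallyIntegrableOn f Q volume ∧ (∃ G, IsWeakGradient Q f G) ∧
    ∀ i, MemLp (fun x => weakGradient Q f x i) p (volume.restrict Q)

/-- `‖ |∇f|_{K°} ‖_{L_p(Q)}`. -/
def gradNorm {d : ℕ} (K Q : Set (E d)) (p : ℝ≥0∞) (f : E d → ℝ) : ℝ≥0∞ :=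
  eLpNorm (fun x => dualNorm K (weakGradient Q f x)) p (volume.restrict Q)

/-- The seminorm `⌋f⌈_h = sup_{x ∈ C} |∫_{hK ∩ C} f (x + u) du|`. -/
def seminormAt {d : ℕ} (K C : Set (E d)) (h : ℝ) (f : E d → ℝ) : ℝ≥0∞ :=
  ⨆ x ∈ C, ‖∫ u in (h • K) ∩ C, f (x + u)‖ₑ

/-- The seminorm `⌋f⌈ = sup_{h > 0} ⌋f⌈_h`. -/
def seminormSup {d : ℕ} (K C : Set (E d)) (f : E d → ℝ) : ℝ≥0∞ :=
  ⨆ (h : ℝ) (_ : 0 < h), seminormAt K C h f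

/-- `W^{1,p}(C) ∩ L_{⌋·⌈_h}(C)`. -/
def classAt {d : ℕ} (K C : Set (E d)) (p : ℝ≥0∞) (h : ℝ) : Set (E d → ℝ) :=
  {f | MemW C p f ∧ seminormAt K C h f < ∞}

/-- `W^{1,p}(C) ∩ L_{⌋·⌈}(C)`. -/
def classSup {d : ℕ} (K C : Set (E d)) (p : ℝ≥0∞) : Set (E d → ℝ) :=
  {f | MemW C p f ∧ seminormSup K C f < ∞}

/-- `W^{1,p}(C) ∩ L_1(C)`. -/
def classL1 {d : ℕ} (C : Set (E d)) (p : ℝ≥0∞) : Set (E d → ℝ) :=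
  {f | MemW C p f ∧ MemLp f 1 (volume.restrict C)}

/-- The conjugate exponent `p' = p / (p - 1)` as a real number (`p' = 1` for `p = ∞`). -/
def conjR (p : ℝ≥0∞) : ℝ := (ENNReal.conjExponent p).toReal

/-- `μ(K ∩ C)`. -/
def vol {d : ℕ} (K C : Set (E d)) : ℝ := volume.real (K ∩ C)

/-- `g_h(u) = (1 / (d μ(K ∩ C))) (1 / u^{d-1} - u / h^d)`. -/
def g {d : ℕ} (K C : Set (E d)) (h u : ℝ) : ℝ :=
  1 / (d * vol K C) * (1 / u ^ (d - 1) - u / h ^ d)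

/-- `‖g_h(|·|_K)‖_{L_{p'}(hK ∩ C)}`. -/
def gNorm {d : ℕ} (K C : Set (E d)) (p : ℝ≥0∞) (h : ℝ) : ℝ≥0∞ :=
  eLpNorm (fun x => g K C h (gauge K x)) (ENNReal.conjExponent p)
    (volume.restrict ((h • K) ∩ C))

/-- The coefficient `μ(K ∩ C)⁻¹ h^{-d}`. -/
def avgConst {d : ℕ} (K C : Set (E d)) (h : ℝ) : ℝ≥0∞ :=
  ENNReal.ofReal ((vol K C)⁻¹ * (h ^ d)⁻¹)

open Classical in
/-- The function `f_{e,h}`: `∫_{|y|_K}^h g_h(u)^{p'-1} du` on `hK`, and `0` outside `hK`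
(only its values on `C` matter). -/
def extremal {d : ℕ} (K C : Set (E d)) (p : ℝ≥0∞) (h : ℝ) (y : E d) : ℝ :=
  if y ∈ h • K then ∫ u in (gauge K y)..h, g K C h u ^ (conjR p - 1) else 0

/-- `A(d,p) = d⁻¹ B(1 - (d-1)p'/d, p'+1)^{1/p'}`. -/
def constA (d : ℕ) (p : ℝ≥0∞) : ℝ :=
  (d : ℝ)⁻¹ *
    ProbabilityTheory.beta (1 - ((d : ℝ) - 1) * conjR p / d) (conjR p + 1) ^ (1 / conjR p)

open Classical in
/-- `α = pd / (p + (p-1)d)`, read as its limit `d / (d+1)` for `p = ∞`. -/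
def alpha (d : ℕ) (p : ℝ≥0∞) : ℝ :=
  if p = ∞ then (d : ℝ) / (d + 1)
  else p.toReal * d / (p.toReal + (p.toReal - 1) * d)

open Classical in
/-- `a(d,p) = ((p-d) A(d,p) / (pd))^α (pd/(p-d) + 1)`, read as its limit
`(A(d,∞) / d)^α (d + 1)` for `p = ∞`. -/
def constSmallA (d : ℕ) (p : ℝ≥0∞) : ℝ :=
  if p = ∞ then (constA d p / d) ^ alpha d p * ((d : ℝ) + 1)
  else ((p.toReal - d) * constA d p / (p.toReal * d)) ^ alpha d p *
    (p.toReal * d / (p.toReal - d) + 1)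

/-- The coefficient `a(d,p) μ(K ∩ C)^{-α/d}` of the multiplicative inequality. -/
def multConst {d : ℕ} (K C : Set (E d)) (p : ℝ≥0∞) : ℝ≥0∞ :=
  ENNReal.ofReal (constSmallA d p * vol K C ^ (-(alpha d p) / d))

/-- `‖f‖_{L_∞(Q)}`. -/
def supNorm {d : ℕ} (Q : Set (E d)) (f : E d → ℝ) : ℝ≥0∞ := eLpNorm f ∞ (volume.restrict Q)

/-- `‖f‖_{L_1(Q)}`. -/
def oneNorm {d : ℕ} (Q : Set (E d)) (f : E d → ℝ) : ℝ≥0∞ := eLpNorm f 1 (volume.restrict Q)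

/-- The inequality `X f ≤ a * Y f + b * Z f` holds on the class `𝓕`, and neither of the constants
`a`, `b` can be decreased. -/
def SharpAdditive {V : Type*} (𝓕 : Set V) (X Y Z : V → ℝ≥0∞) (a b : ℝ≥0∞) : Prop :=
  (∀ f ∈ 𝓕, X f ≤ a * Y f + b * Z f) ∧
  ∀ a' ≤ a, ∀ b' ≤ b, (∀ f ∈ 𝓕, X f ≤ a' * Y f + b' * Z f) → a' = a ∧ b' = b

/-- The inequality `X f ≤ c * Z f ^ (1 - α) * Y f ^ α` holds on the class `𝓕`, and the constant `c`
cannot be decreased. -/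
def SharpMultiplicative {V : Type*} (𝓕 : Set V) (X Y Z : V → ℝ≥0∞) (α : ℝ) (c : ℝ≥0∞) : Prop :=
  IsLeast {c | ∀ f ∈ 𝓕, X f ≤ c * Z f ^ (1 - α) * Y f ^ α} c

end NagyInequality

end

/-!
With `S = hK ∩ C`, everything rests on the identity
`μ(S) f(x) = ∫_S f(x + u) du - ∫_S (f(x + u) - f(x)) du`. The increment `f(x + u) - f(x)` is the
integral of `⟨∇f, u⟩` along the segment from `x` to `x + u`, which stays in `C` because `C` is a
convex cone, and `|⟨∇f, u⟩| ≤ |u|_K |∇f|_{K°}`. Integrating over `u ∈ S` and substituting `v = t u`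
(`lintegral_segment`), the second term is at most `μ(S) ∫_S g_h(|v|_K) |∇f(x + v)|_{K°} dv`, and
Hölder's inequality gives the additive inequality `supNorm_le_gNorm_mul_add`.

For a Sobolev function the argument is run not at a point `x` but for the average of `f` against a
nonnegative test function `ψ` supported in `C`: translating `ψ` by `t u` with `u ∈ C` keeps its
support in `C`, so the definition of the weak gradient applies directly
(`IsWeakGradient.integral_mul_translate_sub`) and neither mollification nor a continuous
representative is needed. A uniform bound for all these averages is an essential bound for `f`
(`ae_abs_le_of_forall_test`).

The extremal function is radial with profile `k = g_h ^ (p' - 1)`, so its gradient has dual norm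
`k(|x|_K)` (`isWeakGradient_radial`, `IsNormBody.dualNorm_of_fderiv_gauge`): this is the equality
case of Hölder's inequality, and `ofReal_mul_profileMass` computes that the additive inequality is
an equality. As it is nonnegative, supported in `hK` and continuous up to the vertex, all the
seminorms agree with its `L_1` norm. One function with equality and nonzero finite norms makes the
constants optimal (`sharpAdditive_of_eq`, `sharpMultiplicative_of_eq`).

Finally `‖g_h‖_{p'} = A(d,p) μ(K ∩ C)^{-1/p} h^{1 - d/p}` is a Beta integral (`gNorm_eq_ofReal`), and
the right side of the multiplicative inequality is the minimum over `h` of the right side of the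
additive one (`exists_minimizer_rpow_add_inv`). The extremal function for `h` satisfies the additive
inequality at every scale, with equality at `h`; hence `h` is a minimizer and the multiplicative
inequality is an equality too (`supNorm_extremal_eq_mul`). Throughout, `p.toReal⁻¹` stands for
`1/p`, which covers `p = ∞` as well.
-/

namespace NagyInequality

open Filter Topology

variable {d : ℕ} {K : Set (E d)} {C : ConvexCone ℝ (E d)} {p : ℝ≥0∞} {h : ℝ}

/-! ### Symmetric convex bodies, their gauge and the dual norm -/

/-- Open bounded convex symmetric neighbourhoods of the origin: the unit balls of norms. -/
structure IsNormBody (K : Set (E d)) : Prop where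
  isOpen : IsOpen K
  convex : Convex ℝ K
  isBounded : Bornology.IsBounded K
  neg_mem : ∀ x ∈ K, -x ∈ K
  zero_mem : (0 : E d) ∈ K

lemma dualNorm_le_of_inner_le {z : E d} {b : ℝ} (hb : 0 ≤ b)
    (h : ∀ x, inner ℝ x z ≤ gauge K x * b) : dualNorm K z ≤ b := by
  refine csSup_le ⟨_, 0, by simp [gauge_zero], rfl⟩ ?_
  rintro _ ⟨x, hx, rfl⟩
  exact (h x).trans (mul_le_of_le_one_left hb hx)

namespace IsNormBody

lemma mem_nhds (hK : IsNormBody K) : K ∈ 𝓝 (0 : E d) := hK.isOpen.mem_nhds hK.zero_mem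

lemma absorbent (hK : IsNormBody K) : Absorbent ℝ K := absorbent_nhds_zero hK.mem_nhds

lemma continuous_gauge (hK : IsNormBody K) : Continuous (gauge K) :=
  _root_.continuous_gauge hK.convex hK.mem_nhds

lemma gauge_smul (hK : IsNormBody K) (t : ℝ) (x : E d) :
    gauge K (t • x) = |t| * gauge K x := by
  rcases le_total 0 t with ht | ht
  · rw [gauge_smul_of_nonneg ht, abs_of_nonneg ht, smul_eq_mul]
  · rw [abs_of_nonpos ht, ← gauge_neg hK.neg_mem, ← neg_smul,
      gauge_smul_of_nonneg (neg_nonneg.2 ht), smul_eq_mul]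

lemma gauge_add_le (hK : IsNormBody K) (x y : E d) :
    gauge K (x + y) ≤ gauge K x + gauge K y :=
  _root_.gauge_add_le hK.convex hK.absorbent x y

lemma gauge_eq_zero (hK : IsNormBody K) {x : E d} : gauge K x = 0 ↔ x = 0 :=
  _root_.gauge_eq_zero hK.absorbent (NormedSpace.isVonNBounded_of_isBounded ℝ hK.isBounded)

lemma gauge_pos (hK : IsNormBody K) {x : E d} : 0 < gauge K x ↔ x ≠ 0 :=
  _root_.gauge_pos hK.absorbent (NormedSpace.isVonNBounded_of_isBounded ℝ hK.isBounded)

lemma mem_iff (hK : IsNormBody K) {x : E d} : x ∈ K ↔ gauge K x < 1 := by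
  have := setOfPred_gauge_lt_one_eq_self_of_isOpen hK.convex hK.zero_mem hK.isOpen
  conv_lhs => rw [← this]
  rfl

lemma mem_smul_iff (hK : IsNormBody K) {h : ℝ} (hh : 0 < h) {x : E d} :
    x ∈ h • K ↔ gauge K x < h := by
  rw [mem_smul_set_iff_inv_smul_mem₀ hh.ne', hK.mem_iff, hK.gauge_smul, abs_of_pos (inv_pos.2 hh),
    inv_mul_lt_iff₀ hh, mul_one]

lemma exists_bounds (hK : IsNormBody K) :
    ∃ r > 0, ∃ R > 0, ∀ x : E d, r * gauge K x ≤ ‖x‖ ∧ ‖x‖ ≤ R * gauge K x := by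
  obtain ⟨r, hr, hrK⟩ := Metric.mem_nhds_iff.1 hK.mem_nhds
  obtain ⟨R, hR, hKR⟩ := hK.isBounded.subset_closedBall_lt 0 (0 : E d)
  refine ⟨r, hr, R, hR, fun x => ⟨mul_gauge_le_norm hrK, ?_⟩⟩
  have := le_gauge_of_subset_closedBall hK.absorbent hR.le hKR (x := x)
  rwa [div_le_iff₀' hR] at this

lemma exists_lipschitz (hK : IsNormBody K) : ∃ L, LipschitzWith L (gauge K) :=
  hK.convex.lipschitz_gauge hK.mem_nhds

lemma bddAbove (hK : IsNormBody K) (z : E d) :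
    BddAbove ((fun x : E d => inner ℝ x z) '' {x | gauge K x ≤ 1}) := by
  obtain ⟨r, hr, R, hR, hb⟩ := hK.exists_bounds
  refine ⟨R * ‖z‖, ?_⟩
  rintro _ ⟨x, hx, rfl⟩
  have hx : gauge K x ≤ 1 := hx
  calc inner ℝ x z ≤ ‖x‖ * ‖z‖ := real_inner_le_norm x z
    _ ≤ (R * gauge K x) * ‖z‖ := by gcongr; exact (hb x).2
    _ ≤ (R * 1) * ‖z‖ := by gcongr
    _ = R * ‖z‖ := by rw [mul_one]

lemma inner_le (hK : IsNormBody K) (x z : E d) :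
    inner ℝ x z ≤ gauge K x * dualNorm K z := by
  rcases eq_or_ne x 0 with rfl | hx
  · simp
  have hx' := hK.gauge_pos.2 hx
  have : inner ℝ ((gauge K x)⁻¹ • x) z ≤ dualNorm K z := by
    refine le_csSup (hK.bddAbove z) ⟨_, ?_, rfl⟩
    change gauge K _ ≤ 1
    rw [hK.gauge_smul, abs_of_pos (inv_pos.2 hx'), inv_mul_cancel₀ hx'.ne']
  rw [real_inner_smul_left, inv_mul_le_iff₀ hx'] at this
  exact this

lemma abs_inner_le (hK : IsNormBody K) (x z : E d) :
    |inner ℝ x z| ≤ gauge K x * dualNorm K z := by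
  refine abs_le'.2 ⟨hK.inner_le x z, ?_⟩
  rw [← inner_neg_left, ← gauge_neg hK.neg_mem]
  exact hK.inner_le _ _

lemma dualNorm_nonneg (hK : IsNormBody K) (z : E d) : 0 ≤ dualNorm K z :=
  le_csSup (hK.bddAbove z) ⟨0, by simp [gauge_zero], by simp⟩

lemma exists_dualNorm_bounds (hK : IsNormBody K) :
    ∃ r > 0, ∃ R > 0, ∀ z : E d, r * ‖z‖ ≤ dualNorm K z ∧ dualNorm K z ≤ R * ‖z‖ := by
  obtain ⟨r, hr, R, hR, hb⟩ := hK.exists_bounds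
  refine ⟨r, hr, R, hR, fun z => ⟨?_, dualNorm_le_of_inner_le (by positivity) fun x => ?_⟩⟩
  · rcases eq_or_ne z 0 with rfl | hz
    · simpa using hK.dualNorm_nonneg 0
    have h1 := hK.inner_le z z
    rw [real_inner_self_eq_norm_mul_norm] at h1
    have h2 : 0 < ‖z‖ := norm_pos_iff.2 hz
    have h3 := mul_le_mul_of_nonneg_right (hb z).1 (hK.dualNorm_nonneg z)
    nlinarith
  · calc inner ℝ x z ≤ ‖x‖ * ‖z‖ := real_inner_le_norm x z
      _ ≤ (R * gauge K x) * ‖z‖ := by gcongr; exact (hb x).2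
      _ = _ := by ring

lemma dualNorm_add_le (hK : IsNormBody K) (z w : E d) :
    dualNorm K (z + w) ≤ dualNorm K z + dualNorm K w :=
  dualNorm_le_of_inner_le (add_nonneg (hK.dualNorm_nonneg _) (hK.dualNorm_nonneg _)) fun x => by
    rw [inner_add_right, mul_add]
    exact add_le_add (hK.inner_le x z) (hK.inner_le x w)

lemma continuous_dualNorm (hK : IsNormBody K) : Continuous (dualNorm K) := by
  obtain ⟨r, hr, R, hR, hb⟩ := hK.exists_dualNorm_bounds
  refine (LipschitzWith.of_le_add_mul (K := ⟨R, hR.le⟩) fun z w => ?_).continuous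
  have h1 := hK.dualNorm_add_le w (z - w)
  rw [add_sub_cancel] at h1
  rw [dist_eq_norm]
  exact h1.trans (add_le_add le_rfl (hb _).2)

/-- The gradient of the norm `|·|_K` has dual norm `1`, by homogeneity and the triangle
inequality; the factor `k` allows for radial functions. -/
lemma dualNorm_of_fderiv_gauge (hK : IsNormBody K) {y z : E d} {k : ℝ} (hy : y ≠ 0)
    (hd : DifferentiableAt ℝ (gauge K) y)
    (hz : ∀ v, inner ℝ v z = k * fderiv ℝ (gauge K) y v) : dualNorm K z = |k| := by
  have hup : ∀ v, fderiv ℝ (gauge K) y v ≤ gauge K v := by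
    intro v
    have h1 : HasDerivAt (fun t : ℝ => gauge K (y + t • v)) (fderiv ℝ (gauge K) y v) 0 :=
      hd.hasFDerivAt.hasLineDerivAt v
    have h2 := h1.tendsto_slope_zero_right
    refine le_of_tendsto h2 ?_
    filter_upwards [self_mem_nhdsWithin] with t (ht : 0 < t)
    have := hK.gauge_add_le y (t • v)
    rw [hK.gauge_smul, abs_of_pos ht] at this
    simp only [zero_add, zero_smul, add_zero, smul_eq_mul]
    rw [inv_mul_le_iff₀ ht]
    linarith
  have hyy : fderiv ℝ (gauge K) y y = gauge K y := by
    have h1 : HasDerivAt (fun t : ℝ => gauge K (y + t • y)) (fderiv ℝ (gauge K) y y) 0 :=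
      hd.hasFDerivAt.hasLineDerivAt y
    have h2 : HasDerivAt (fun t : ℝ => (1 + t) * gauge K y) (1 * gauge K y) 0 :=
      ((hasDerivAt_id (0 : ℝ)).const_add 1).mul_const _
    have h3 : (fun t : ℝ => gauge K (y + t • y)) =ᶠ[𝓝 0] fun t => (1 + t) * gauge K y := by
      filter_upwards [Ioi_mem_nhds (show (-1 : ℝ) < 0 by norm_num)] with t (ht : -1 < t)
      rw [show y + t • y = (1 + t) • y by rw [add_smul, one_smul], hK.gauge_smul,
        abs_of_pos (by linarith)]
    rw [h1.unique (h2.congr_of_eventuallyEq h3), one_mul]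
  refine le_antisymm (dualNorm_le_of_inner_le (abs_nonneg k) fun x => ?_) ?_
  · have h1 : |fderiv ℝ (gauge K) y x| ≤ gauge K x := by
      refine abs_le'.2 ⟨hup x, ?_⟩
      rw [← map_neg, ← gauge_neg hK.neg_mem]
      exact hup _
    rw [hz, mul_comm (gauge K x)]
    exact (le_abs_self _).trans (by rw [abs_mul]; gcongr)
  · have h1 := hK.abs_inner_le y z
    rw [hz, hyy, abs_mul, abs_of_nonneg (gauge_nonneg y), mul_comm] at h1
    exact le_of_mul_le_mul_left h1 (hK.gauge_pos.2 hy)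

end IsNormBody

/-! ### The truncated cone -/

section Cone

variable {C : ConvexCone ℝ (E d)}

lemma add_mem_cone {x y : E d} (hx : x ∈ (C : Set (E d))) (hy : y ∈ (C : Set (E d))) :
    x + y ∈ (C : Set (E d)) := C.add_mem hx hy

lemma smul_mem_cone {t : ℝ} (ht : 0 < t) {x : E d} :
    t • x ∈ (C : Set (E d)) ↔ x ∈ (C : Set (E d)) := by
  refine ⟨fun h => ?_, fun h => C.smul_mem ht h⟩
  have := C.smul_mem (inv_pos.2 ht) h
  rwa [smul_smul, inv_mul_cancel₀ ht.ne', one_smul] at this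

/-- Translating an open convex cone by one of its points moves its closure inside it. -/
lemma add_mem_cone_of_mem_closure (hCo : IsOpen (C : Set (E d))) {x y : E d}
    (hx : x ∈ (C : Set (E d))) (hy : y ∈ closure (C : Set (E d))) :
    x + y ∈ (C : Set (E d)) := by
  have h1 : (fun z => x + y - z) ⁻¹' (C : Set (E d)) ∈ 𝓝 y := by
    refine (continuous_const.sub continuous_id).continuousAt.preimage_mem_nhds ?_
    simpa using hCo.mem_nhds hx
  obtain ⟨z, hz1, hz2⟩ := mem_closure_iff_nhds.1 hy _ h1
  have := add_mem_cone hz1 hz2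
  simpa using this

lemma zero_mem_closure_cone (hCn : (C : Set (E d)).Nonempty) :
    (0 : E d) ∈ closure (C : Set (E d)) := by
  obtain ⟨x, hx⟩ := hCn
  have h : Tendsto (fun t : ℝ => t • x) (𝓝[>] 0) (𝓝 0) := by
    have : Tendsto (fun t : ℝ => t • x) (𝓝 0) (𝓝 ((0 : ℝ) • x)) :=
      (continuous_id.smul continuous_const).tendsto 0
    rw [zero_smul] at this
    exact this.mono_left nhdsWithin_le_nhds
  refine mem_closure_of_tendsto h ?_
  filter_upwards [self_mem_nhdsWithin] with t (ht : 0 < t) using (smul_mem_cone ht).2 hx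

lemma smul_inter_cone (K : Set (E d)) {h : ℝ} (hh : 0 < h) :
    (h • K) ∩ (C : Set (E d)) = h • (K ∩ (C : Set (E d))) := by
  ext x
  rw [mem_inter_iff, mem_smul_set_iff_inv_smul_mem₀ hh.ne', mem_smul_set_iff_inv_smul_mem₀ hh.ne',
    mem_inter_iff, smul_mem_cone (inv_pos.2 hh)]

lemma isOpen_smul_inter (hK : IsNormBody K) (hCo : IsOpen (C : Set (E d))) {h : ℝ} (hh : 0 < h) :
    IsOpen ((h • K) ∩ (C : Set (E d))) := (hK.isOpen.smul₀ hh.ne').inter hCo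

lemma vol_pos (hK : IsNormBody K) (hCo : IsOpen (C : Set (E d))) (hCn : (C : Set (E d)).Nonempty) :
    0 < vol K C := by
  have hne : (K ∩ (C : Set (E d))).Nonempty :=
    mem_closure_iff_nhds.1 (zero_mem_closure_cone hCn) K hK.mem_nhds
  refine ENNReal.toReal_pos ((hK.isOpen.inter hCo).measure_pos volume hne).ne' ?_
  exact ((hK.isBounded.subset inter_subset_left).measure_lt_top).ne

lemma ofReal_vol (hK : IsNormBody K) :
    ENNReal.ofReal (vol K C) = volume (K ∩ (C : Set (E d))) :=
  ENNReal.ofReal_toReal (hK.isBounded.subset inter_subset_left).measure_lt_top.ne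

lemma volume_smul_inter (hK : IsNormBody K) {h : ℝ} (hh : 0 < h) :
    volume ((h • K) ∩ (C : Set (E d))) = ENNReal.ofReal (h ^ d * vol K C) := by
  rw [smul_inter_cone K hh, Measure.addHaar_smul, ENNReal.ofReal_mul (by positivity), ofReal_vol hK,
    finrank_euclideanSpace_fin, abs_of_pos (by positivity)]

lemma isBounded_smul_inter (hK : IsNormBody K) (C : ConvexCone ℝ (E d)) (h : ℝ) :
    Bornology.IsBounded ((h • K) ∩ (C : Set (E d))) :=
  (hK.isBounded.smul₀ h).subset inter_subset_left

end Cone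

/-! ### Integration of radial functions over the truncated cone -/

lemma lintegral_Ioo_eq_ofReal_intervalIntegral {a b : ℝ} (hab : a ≤ b) {f : ℝ → ℝ}
    (hf : IntegrableOn f (Ioo a b)) (h0 : ∀ u ∈ Ioo a b, 0 ≤ f u) :
    ∫⁻ u in Ioo a b, ENNReal.ofReal (f u) = ENNReal.ofReal (∫ u in a..b, f u) := by
  rw [intervalIntegral.integral_of_le hab, integral_Ioc_eq_integral_Ioo,
    ofReal_integral_eq_lintegral_ofReal hf]
  exact (ae_restrict_iff' measurableSet_Ioo).2 (ae_of_all _ h0)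

lemma lintegral_Ioo_pow (hd : 1 ≤ d) {m : ℝ} (hm : 0 ≤ m) :
    ∫⁻ u in Ioo 0 m, ENNReal.ofReal (u ^ (d - 1)) = ENNReal.ofReal (m ^ d / d) := by
  rw [lintegral_Ioo_eq_ofReal_intervalIntegral hm
    ((continuous_pow _).integrableOn_Icc.mono_set Ioo_subset_Icc_self)
    (fun u hu => pow_nonneg hu.1.le _), integral_pow, Nat.sub_add_cancel hd]
  congr 1
  have : ((d - 1 : ℕ) : ℝ) + 1 = d := by exact_mod_cast Nat.sub_add_cancel hd
  rw [this, zero_pow (by omega), sub_zero]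

/-- Integration in polar coordinates with respect to `|·|_K`: both sides are integrals against
finite measures on the line, which agree on the half-lines `(-∞, r)` by homogeneity of the
volume. -/
lemma lintegral_radial (hd : 1 ≤ d) (hK : IsNormBody K) (hCo : IsOpen (C : Set (E d)))
    {h : ℝ} (hh : 0 < h) {F : ℝ → ℝ≥0∞} (hF : Measurable F) :
    ∫⁻ x in (h • K) ∩ (C : Set (E d)), F (gauge K x) =
      ENNReal.ofReal (d * vol K C) * ∫⁻ u in Ioo 0 h, F u * ENNReal.ofReal (u ^ (d - 1)) := by
  have hd0 : (0 : ℝ) < d := by exact_mod_cast hd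
  have hv : 0 ≤ vol K C := measureReal_nonneg
  have hpow : Measurable fun u : ℝ => ENNReal.ofReal (u ^ (d - 1)) := by fun_prop
  have hg : Measurable (gauge K) := hK.continuous_gauge.measurable
  set S := (h • K) ∩ (C : Set (E d)) with hS
  have hSm : MeasurableSet S := (isOpen_smul_inter hK hCo hh).measurableSet
  have hfin : IsFiniteMeasure ((volume.restrict S).map (gauge K)) := by
    have : IsFiniteMeasure (volume.restrict S) :=
      ⟨by rw [Measure.restrict_apply_univ]; exact (isBounded_smul_inter hK C h).measure_lt_top⟩
    infer_instance
  have key : ∀ m, 0 ≤ m → ENNReal.ofReal (d * vol K C) *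
      ∫⁻ u in Ioo 0 m, ENNReal.ofReal (u ^ (d - 1)) = ENNReal.ofReal (m ^ d * vol K C) := by
    intro m hm
    rw [lintegral_Ioo_pow hd hm, ← ENNReal.ofReal_mul (by positivity)]
    congr 1
    field_simp
  have hμ : (volume.restrict S).map (gauge K) = ENNReal.ofReal (d * vol K C) •
      (volume.restrict (Ioo 0 h)).withDensity (fun u => ENNReal.ofReal (u ^ (d - 1))) := by
    refine ext_of_generate_finite _ (borel_eq_generateFrom_Iio ℝ ▸
      (BorelSpace.measurable_eq (α := ℝ))) isPiSystem_Iio ?_ ?_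
    · rintro _ ⟨r, rfl⟩
      rw [Measure.map_apply hg measurableSet_Iio,
        Measure.restrict_apply (hg measurableSet_Iio), Measure.smul_apply,
        withDensity_apply _ measurableSet_Iio, Measure.restrict_restrict measurableSet_Iio,
        smul_eq_mul]
      rcases le_or_gt r 0 with hr | hr
      · have h1 : gauge K ⁻¹' Iio r = ∅ := by
          ext x
          simpa using hr.trans (gauge_nonneg x)
        have h2 : Iio r ∩ Ioo 0 h = ∅ := by
          ext u
          simp only [mem_inter_iff, mem_Iio, mem_Ioo, mem_empty_iff_false, iff_false]
          rintro ⟨h1, h2, -⟩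
          linarith
        simp [h1, h2]
      · have h1 : gauge K ⁻¹' Iio r ∩ S = (min r h • K) ∩ (C : Set (E d)) := by
          ext x
          rw [hS, mem_inter_iff, mem_inter_iff, mem_inter_iff, hK.mem_smul_iff hh,
            hK.mem_smul_iff (lt_min hr hh), lt_min_iff, and_assoc]
          rfl
        have h2 : Iio r ∩ Ioo 0 h = Ioo 0 (min r h) := by
          ext u
          simp only [mem_inter_iff, mem_Iio, mem_Ioo, lt_min_iff]
          tauto
        rw [h1, h2, volume_smul_inter hK (lt_min hr hh), key _ (lt_min hr hh).le]
    · rw [Measure.map_apply hg MeasurableSet.univ, preimage_univ, Measure.restrict_apply_univ,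
        Measure.smul_apply, withDensity_apply _ MeasurableSet.univ, Measure.restrict_univ,
        smul_eq_mul, key h hh.le, hS, volume_smul_inter hK hh]
  rw [← lintegral_map hF hg, hμ, lintegral_smul_measure, lintegral_withDensity_eq_lintegral_mul _
    hpow hF, smul_eq_mul]
  congr 1
  refine lintegral_congr fun u => ?_
  rw [Pi.mul_apply, mul_comm]

lemma volume_gauge_eq (hK : IsNormBody K) {r : ℝ} (hr : 0 < r) :
    volume {x : E d | gauge K x = r} = 0 := by
  refine measure_mono_null (t := frontier (r • K)) ?_
    ((hK.convex.smul r).addHaar_frontier volume)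
  intro x (hx : gauge K x = r)
  have hopen : IsOpen (r • K) := hK.isOpen.smul₀ hr.ne'
  rw [hopen.frontier_eq]
  refine ⟨?_, fun h => by rw [hK.mem_smul_iff hr] at h; linarith⟩
  have hx0 : Tendsto (fun t : ℝ => t • x) (𝓝[<] 1) (𝓝 x) := by
    have : Tendsto (fun t : ℝ => t • x) (𝓝 1) (𝓝 ((1 : ℝ) • x)) :=
      (continuous_id.smul continuous_const).tendsto 1
    rw [one_smul] at this
    exact this.mono_left nhdsWithin_le_nhds
  refine mem_closure_of_tendsto hx0 ?_
  filter_upwards [self_mem_nhdsWithin, Ioo_mem_nhdsLT (show (0 : ℝ) < 1 by norm_num)]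
    with t (ht : t < 1) ht0
  rw [hK.mem_smul_iff hr, hK.gauge_smul, hx, abs_of_pos ht0.1]
  nlinarith [ht0.1]

/-! ### Weak gradients -/

lemma integrable_mul_of_tsupport_subset {Q : Set (E d)} {f φ : E d → ℝ}
    (hf : LocallyIntegrableOn f Q volume) (hφ : Continuous φ) (hc : HasCompactSupport φ)
    (hs : tsupport φ ⊆ Q) : Integrable (fun x => f x * φ x) volume := by
  have h1 : IntegrableOn (fun x => f x * φ x) (tsupport φ) volume :=
    (hf.integrableOn_compact_subset hs hc).mul_continuousOn hφ.continuousOn hc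
  refine (integrableOn_iff_integrable_of_support_subset fun x hx => ?_).1 h1
  exact subset_tsupport φ fun h0 => hx (by simp [h0])

lemma inner_eq_sum_coord (u z : E d) : inner ℝ u z = ∑ i, u i * z i := by
  rw [PiLp.inner_apply]
  exact Finset.sum_congr rfl fun i _ => by simp [mul_comm]

lemma map_eq_sum_coord (L : E d →L[ℝ] ℝ) (u : E d) :
    L u = ∑ i, u i * L (EuclideanSpace.single i 1) := by
  conv_lhs => rw [← (EuclideanSpace.basisFun (Fin d) ℝ).sum_repr u]
  simp [map_sum]

/-- The defining identity of a weak gradient, tested in an arbitrary direction. -/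
lemma IsWeakGradient.integral_mul_fderiv {Q : Set (E d)} {f : E d → ℝ} {G : E d → E d}
    (hG : IsWeakGradient Q f G) (hf : LocallyIntegrableOn f Q volume) {φ : E d → ℝ}
    (hφ : ContDiff ℝ (⊤ : ℕ∞) φ) (hc : HasCompactSupport φ) (hs : tsupport φ ⊆ Q) (u : E d) :
    ∫ x in Q, f x * fderiv ℝ φ x u = - ∫ x in Q, inner ℝ u (G x) * φ x := by
  have hi : ∀ i, Integrable (fun x => f x * fderiv ℝ φ x (EuclideanSpace.single i 1)) volume := by
    intro i
    refine integrable_mul_of_tsupport_subset hf ?_ (hc.fderiv_apply ℝ _)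
      ((tsupport_fderiv_apply_subset ℝ _).trans hs)
    exact (hφ.continuous_fderiv (by simp)).clm_apply continuous_const
  have hi' : ∀ i, Integrable (fun x => G x i * φ x) volume := fun i =>
    integrable_mul_of_tsupport_subset (hG.1 i) hφ.continuous hc hs
  have e1 : ∀ x, f x * fderiv ℝ φ x u =
      ∑ i, u i * (f x * fderiv ℝ φ x (EuclideanSpace.single i 1)) := by
    intro x
    rw [map_eq_sum_coord, Finset.mul_sum]
    exact Finset.sum_congr rfl fun i _ => by ring
  have e2 : ∀ x, inner ℝ u (G x) * φ x = ∑ i, u i * (G x i * φ x) := by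
    intro x
    rw [inner_eq_sum_coord, Finset.sum_mul]
    exact Finset.sum_congr rfl fun i _ => by ring
  simp_rw [e1, e2]
  rw [integral_finsetSum _ fun i _ => ((hi i).const_mul _).restrict,
    integral_finsetSum _ fun i _ => ((hi' i).const_mul _).restrict, ← Finset.sum_neg_distrib]
  refine Finset.sum_congr rfl fun i _ => ?_
  rw [integral_const_mul, integral_const_mul, hG.2 φ hφ hc hs i, mul_neg]

/-- The average of `f` against a test function changes, under a translation by a vector `u` of the
cone, by the average of the derivative of `f` in the direction `u` along the segment. -/
lemma IsWeakGradient.integral_mul_translate_sub (hCo : IsOpen (C : Set (E d)))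
    {f : E d → ℝ} {G : E d → E d} (hG : IsWeakGradient (C : Set (E d)) f G)
    (hf : LocallyIntegrableOn f (C : Set (E d)) volume)
    {ψ : E d → ℝ} (hψ : ContDiff ℝ (⊤ : ℕ∞) ψ) (hc : HasCompactSupport ψ)
    (hs : tsupport ψ ⊆ C) {u : E d} (hu : u ∈ (C : Set (E d))) :
    ∫ x in C, f x * (ψ (x - u) - ψ x) =
      ∫ t in Ioc (0 : ℝ) 1, ∫ x in C, inner ℝ u (G x) * ψ (x - t • u) := by
  -- all the translates live on the compact set `T`, contained in the cone
  set T : Set (E d) := (fun q : E d × ℝ => q.1 + q.2 • u) '' (tsupport ψ ×ˢ Icc (0 : ℝ) 1)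
  have hTc : IsCompact T := (hc.isCompact.prod isCompact_Icc).image (by fun_prop)
  have hTC : T ⊆ C := by
    rintro _ ⟨⟨a, t⟩, ⟨ha, ht⟩, rfl⟩
    rcases ht.1.eq_or_lt with h0 | h0
    · simp only at h0
      simpa [← h0] using hs ha
    · exact add_mem_cone (hs ha) ((smul_mem_cone h0).2 hu)
  have hmemT : ∀ {x : E d} {t : ℝ}, t ∈ Icc (0 : ℝ) 1 → x - t • u ∈ tsupport ψ → x ∈ T :=
    fun {x t} ht hx => ⟨⟨x - t • u, t⟩, ⟨hx, ht⟩, by simp⟩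
  set f0 : E d → ℝ := T.indicator f with hf0
  have hf0i : Integrable f0 volume :=
    (integrable_indicator_iff hTc.measurableSet).2 (hf.integrableOn_compact_subset hTC hTc)
  have hdψ : Continuous (fun x => fderiv ℝ ψ x u) :=
    (hψ.continuous_fderiv (by simp)).clm_apply continuous_const
  obtain ⟨B, hB⟩ := hdψ.bounded_above_of_compact_support (hc.fderiv_apply ℝ u)
  have hmul : ∀ {t : ℝ} {F : E d → ℝ}, t ∈ Icc (0 : ℝ) 1 →
      (∀ y, y ∉ tsupport ψ → F y = 0) → ∀ x,
      (C : Set (E d)).indicator (fun x => f x * F (x - t • u)) x = f0 x * F (x - t • u) := by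
    intro t F ht hF x
    by_cases hx : x - t • u ∈ tsupport ψ
    · rw [hf0, indicator_of_mem (hmemT ht hx), indicator_of_mem (hTC (hmemT ht hx))]
    · simp [indicator, hF _ hx]
  have hψ0 : ∀ y, y ∉ tsupport ψ → ψ y = 0 := fun y hy => image_eq_zero_of_notMem_tsupport hy
  have hdψ0 : ∀ y, y ∉ tsupport ψ → fderiv ℝ ψ y u = 0 := fun y hy =>
    image_eq_zero_of_notMem_tsupport (f := fun y => fderiv ℝ ψ y u) fun h =>
      hy (tsupport_fderiv_apply_subset ℝ u h)
  have hCm : MeasurableSet (C : Set (E d)) := hCo.measurableSet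
  have hcompact : ∫ x in C, f x * (ψ (x - u) - ψ x) = ∫ x, f0 x * (ψ (x - u) - ψ x) := by
    rw [← integral_indicator hCm]
    refine integral_congr_ae (ae_of_all _ fun x => ?_)
    have h1 := hmul (t := 1) (by simp) hψ0 x
    have h0 := hmul (t := 0) (by simp) hψ0 x
    simp only [one_smul, zero_smul, sub_zero] at h0 h1
    by_cases hx : x ∈ (C : Set (E d))
    · simp only [indicator_of_mem hx] at h0 h1 ⊢
      rw [mul_sub, mul_sub, h0, h1]
    · simp only [indicator_of_notMem hx] at h0 h1 ⊢
      rw [mul_sub, ← h0, ← h1, sub_zero]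
  have hftc : ∀ x, ψ (x - u) - ψ x = ∫ t in Ioc (0 : ℝ) 1, -fderiv ℝ ψ (x - t • u) u := by
    intro x
    rw [← intervalIntegral.integral_of_le zero_le_one]
    have hder : ∀ t : ℝ, HasDerivAt (fun t : ℝ => ψ (x - t • u)) (-fderiv ℝ ψ (x - t • u) u) t := by
      intro t
      have h1 : HasDerivAt (fun t : ℝ => x - t • u) (-u) t := by
        simpa using ((hasDerivAt_id t).smul_const u).const_sub x
      have h2 := ((hψ.differentiable (by simp)).differentiableAt
        (x := x - t • u)).hasFDerivAt.comp_hasDerivAt t h1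
      rw [map_neg] at h2
      exact h2
    rw [intervalIntegral.integral_eq_sub_of_hasDerivAt (fun t _ => hder t)]
    · simp
    · refine Continuous.intervalIntegrable ?_ _ _
      exact (hdψ.comp (by fun_prop : Continuous fun t : ℝ => x - t • u)).neg
  have hint : Integrable (Function.uncurry fun (x : E d) (t : ℝ) =>
      f0 x * -fderiv ℝ ψ (x - t • u) u) (volume.prod (volume.restrict (Ioc (0 : ℝ) 1))) := by
    have h1 : Integrable (fun z : E d × ℝ => f0 z.1 * (1 : ℝ))
        (volume.prod (volume.restrict (Ioc (0 : ℝ) 1))) :=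
      Integrable.mul_prod (g := fun _ => (1 : ℝ)) hf0i (integrable_const _)
    simp only [mul_one] at h1
    refine h1.mul_bdd (c := B) ?_ (ae_of_all _ fun z => by simpa using hB _)
    refine Continuous.aestronglyMeasurable ?_
    exact (hdψ.comp (by fun_prop : Continuous fun z : E d × ℝ => z.1 - z.2 • u)).neg
  rw [hcompact]
  simp_rw [hftc, ← integral_const_mul]
  rw [integral_integral_swap hint]
  refine setIntegral_congr_fun measurableSet_Ioc fun t ht => ?_
  have ht' : t ∈ Icc (0 : ℝ) 1 := ⟨ht.1.le, ht.2⟩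
  have hφ : ContDiff ℝ (⊤ : ℕ∞) fun x => ψ (x - t • u) := hψ.comp (contDiff_id.sub contDiff_const)
  have htr : (fun x => ψ (x - t • u)) = ψ ∘ Homeomorph.addRight (-(t • u)) := by
    ext x; simp [sub_eq_add_neg]
  have hφc : HasCompactSupport fun x => ψ (x - t • u) := by
    rw [htr]; exact hc.comp_homeomorph _
  have hφs : tsupport (fun x => ψ (x - t • u)) ⊆ C := by
    rw [htr, tsupport_comp_eq_preimage]
    intro x hx
    refine hTC (hmemT ht' ?_)
    simpa [sub_eq_add_neg] using hx
  have hfd : ∀ x, fderiv ℝ (fun x => ψ (x - t • u)) x u = fderiv ℝ ψ (x - t • u) u := by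
    intro x
    simp only [sub_eq_add_neg]
    rw [fderiv_comp_add_right]
  have hw := hG.integral_mul_fderiv hf hφ hφc hφs u
  simp only [hfd] at hw
  simp only [mul_neg, integral_neg]
  rw [← neg_eq_iff_eq_neg.2 hw, ← integral_indicator hCm]
  congr 1
  exact integral_congr_ae (ae_of_all _ fun x => (hmul ht' hdψ0 x).symm)

/-! ### Averages over segments issuing from the vertex -/

lemma measurable_g (K C : Set (E d)) (h : ℝ) : Measurable (g K C h) := by
  unfold g
  fun_prop

/-- The weight that the substitution `v = t u` in averages over segments attaches to the points `v`
with `|v|_K = s`. -/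
lemma lintegral_segment_kernel (hK : IsNormBody K) (hd : 1 ≤ d) (hCo : IsOpen (C : Set (E d)))
    (hCn : (C : Set (E d)).Nonempty) {h s : ℝ} (hs : 0 < s) (hsh : s < h) :
    ∫⁻ t in Ioo (s / h) 1, ENNReal.ofReal ((t ^ d)⁻¹ * (s / t)) =
      ENNReal.ofReal (h ^ d * vol K C) * ENNReal.ofReal (g K C h s) := by
  have hh : 0 < h := hs.trans hsh
  have hv := vol_pos hK hCo hCn
  have hd0 : (0 : ℝ) < d := by exact_mod_cast hd
  have ha : 0 < s / h := div_pos hs hh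
  have ha1 : s / h ≤ 1 := (div_le_one hh).2 hsh.le
  have hcont : ContinuousOn (fun t : ℝ => (t ^ d)⁻¹ * (s / t)) (Icc (s / h) 1) := by
    have : ∀ t ∈ Icc (s / h) 1, t ≠ 0 := fun t ht => (ha.trans_le ht.1).ne'
    refine ContinuousOn.mul (ContinuousOn.inv₀ (by fun_prop) fun t ht => pow_ne_zero _ (this t ht))
      (continuousOn_const.div continuousOn_id this)
  rw [lintegral_Ioo_eq_ofReal_intervalIntegral ha1
    (hcont.integrableOn_Icc.mono_set Ioo_subset_Icc_self), ← ENNReal.ofReal_mul (by positivity)]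
  swap
  · intro t ht
    have := ha.trans ht.1
    positivity
  congr 1
  have hz : ∀ t : ℝ, (t ^ d)⁻¹ * (s / t) = s * t ^ (-(d + 1 : ℕ) : ℤ) := by
    intro t
    rw [zpow_neg, zpow_natCast, pow_succ, mul_inv]
    ring
  simp_rw [hz]
  have h0 : (0 : ℝ) ∉ uIcc (s / h) 1 := by
    rw [uIcc_of_le ha1]
    exact fun h0 => absurd h0.1 (not_le.2 ha)
  rw [intervalIntegral.integral_const_mul, integral_zpow (Or.inr ⟨by omega, h0⟩)]
  have he : (-(d + 1 : ℕ) : ℤ) + 1 = -(d : ℕ) := by push_cast; ring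
  rw [he, zpow_neg, zpow_neg, zpow_natCast, zpow_natCast, one_pow, inv_one, div_pow, inv_div, g]
  have hc : ((-(d + 1 : ℕ) : ℤ) : ℝ) + 1 = -d := by push_cast; ring
  have hsd : s ^ d = s ^ (d - 1) * s := by rw [← pow_succ, Nat.sub_add_cancel hd]
  rw [hc, hsd]
  have : 0 < s ^ (d - 1) := by positivity
  field_simp
  ring

lemma volume_singleton_zero (hd : 1 ≤ d) : volume ({0} : Set (E d)) = 0 := by
  have : Nonempty (Fin d) := ⟨⟨0, hd⟩⟩
  exact measure_singleton _

/-- Averaging a function over the segments from the vertex to the points of `hK ∩ C` produces the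
kernel `g_h`, by the substitution `v = t u`. -/
lemma lintegral_segment (hd : 1 ≤ d) (hK : IsNormBody K) (hCo : IsOpen (C : Set (E d)))
    (hCn : (C : Set (E d)).Nonempty) {h : ℝ} (hh : 0 < h) {N : E d → ℝ≥0∞} (hN : Measurable N) :
    ∫⁻ u in (h • K) ∩ (C : Set (E d)), ∫⁻ t in Ioo (0 : ℝ) 1,
        ENNReal.ofReal (gauge K u) * N (t • u) =
      ENNReal.ofReal (h ^ d * vol K C) * ∫⁻ v in (h • K) ∩ (C : Set (E d)),
        ENNReal.ofReal (g K C h (gauge K v)) * N v := by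
  have hg : Measurable (gauge K) := hK.continuous_gauge.measurable
  have hCm : MeasurableSet (C : Set (E d)) := hCo.measurableSet
  set S := (h • K) ∩ (C : Set (E d)) with hS
  have hSm : MeasurableSet S := (isOpen_smul_inter hK hCo hh).measurableSet
  have hmemS : ∀ {v : E d}, v ∈ S ↔ gauge K v < h ∧ v ∈ (C : Set (E d)) := by
    intro v; rw [hS, mem_inter_iff, hK.mem_smul_iff hh]
  -- the integrand after the substitution `v = t u`
  set H : E d → ℝ → ℝ≥0∞ := fun v t => {q : E d × ℝ | gauge K q.1 < q.2 * h ∧ q.1 ∈ C}.indicator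
    (fun q => ENNReal.ofReal ((q.2 ^ d)⁻¹ * (gauge K q.1 / q.2)) * N q.1) (v, t) with hH
  have hset : MeasurableSet {q : E d × ℝ | gauge K q.1 < q.2 * h ∧ q.1 ∈ C} := by
    have h1 : MeasurableSet {q : E d × ℝ | gauge K q.1 < q.2 * h} :=
      measurableSet_lt (by fun_prop) (by fun_prop)
    exact h1.inter (measurable_fst hCm)
  have hHm : Measurable (Function.uncurry H) := by
    refine Measurable.indicator ?_ hset
    exact Measurable.mul (by fun_prop) (hN.comp measurable_fst)
  have hleft : Measurable (Function.uncurry fun (u : E d) (t : ℝ) =>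
      ENNReal.ofReal (gauge K u) * N (t • u)) := by
    refine Measurable.mul (by fun_prop) (hN.comp ?_)
    fun_prop
  rw [lintegral_lintegral_swap hleft.aemeasurable]
  have hsub : ∀ t ∈ Ioo (0 : ℝ) 1,
      ∫⁻ u in S, ENNReal.ofReal (gauge K u) * N (t • u) = ∫⁻ v, H v t := by
    intro t ht
    have hHt0 : Measurable fun v => H v t := hHm.comp measurable_prodMk_right
    have hHt : Measurable fun v => ENNReal.ofReal (t ^ d) * H v t := hHt0.const_mul _
    have h1 : ∫⁻ u in S, ENNReal.ofReal (gauge K u) * N (t • u) =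
        ∫⁻ u, ENNReal.ofReal (t ^ d) * H (t • u) t := by
      rw [← lintegral_indicator hSm]
      refine lintegral_congr fun u => ?_
      have hiff : ((t • u, t) : E d × ℝ) ∈ {q : E d × ℝ | gauge K q.1 < q.2 * h ∧ q.1 ∈ C} ↔
          u ∈ S := by
        rw [hmemS]
        change gauge K (t • u) < t * h ∧ t • u ∈ (C : Set (E d)) ↔ _
        rw [hK.gauge_smul, abs_of_pos ht.1, smul_mem_cone ht.1, mul_lt_mul_iff_right₀ ht.1]
      by_cases hu : u ∈ S
      · rw [indicator_of_mem hu]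
        simp only [hH]
        rw [indicator_of_mem (hiff.2 hu), ← mul_assoc,
          ← ENNReal.ofReal_mul (by have := ht.1; positivity)]
        congr 2
        simp only
        rw [hK.gauge_smul, abs_of_pos ht.1]
        have := ht.1
        field_simp
      · rw [indicator_of_notMem hu]
        simp only [hH]
        rw [indicator_of_notMem (fun h => hu (hiff.1 h)), mul_zero]
    rw [h1, ← lintegral_map (f := fun v => ENNReal.ofReal (t ^ d) * H v t) hHt
      (measurable_const_smul t), Measure.map_addHaar_smul _ ht.1.ne', lintegral_smul_measure,
      lintegral_const_mul _ hHt0, smul_eq_mul, ← mul_assoc,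
      ← ENNReal.ofReal_mul (abs_nonneg _), finrank_euclideanSpace_fin,
      abs_of_pos (by have := ht.1; positivity),
      inv_mul_cancel₀ (by have := ht.1; positivity), ENNReal.ofReal_one, one_mul]
  rw [setLIntegral_congr_fun measurableSet_Ioo hsub,
    ← lintegral_lintegral_swap (f := H) hHm.aemeasurable,
    ← lintegral_const_mul' _ _ ENNReal.ofReal_ne_top, ← lintegral_indicator hSm]
  refine lintegral_congr_ae ?_
  have h0 : ∀ᵐ v : E d, v ≠ 0 := by
    rw [ae_iff]
    simpa using volume_singleton_zero hd
  filter_upwards [h0] with v hv0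
  have hγ := hK.gauge_pos.2 hv0
  by_cases hv : v ∈ S
  · obtain ⟨hv1, hv2⟩ := hmemS.1 hv
    rw [indicator_of_mem hv, ← mul_assoc, ← lintegral_segment_kernel hK hd hCo hCn hγ hv1,
      ← lintegral_mul_const _ (by fun_prop), ← lintegral_indicator measurableSet_Ioo,
      ← lintegral_indicator measurableSet_Ioo]
    refine lintegral_congr fun t => ?_
    have hiff : t ∈ Ioo (gauge K v / h) 1 ↔ t ∈ Ioo (0 : ℝ) 1 ∧
        ((v, t) : E d × ℝ) ∈ {q : E d × ℝ | gauge K q.1 < q.2 * h ∧ q.1 ∈ C} := by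
      constructor
      · rintro ⟨h1, h2⟩
        exact ⟨⟨(div_pos hγ hh).trans h1, h2⟩, (div_lt_iff₀ hh).1 h1, hv2⟩
      · rintro ⟨⟨h1, h2⟩, h3, -⟩
        exact ⟨(div_lt_iff₀ hh).2 h3, h2⟩
    by_cases ht : t ∈ Ioo (gauge K v / h) 1
    · rw [indicator_of_mem ht, indicator_of_mem (hiff.1 ht).1]
      simp only [hH]
      rw [indicator_of_mem (hiff.1 ht).2]
    · rw [indicator_of_notMem ht]
      by_cases ht1 : t ∈ Ioo (0 : ℝ) 1
      · rw [indicator_of_mem ht1]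
        simp only [hH]
        rw [indicator_of_notMem fun h => ht (hiff.2 ⟨ht1, h⟩)]
      · rw [indicator_of_notMem ht1]
  · rw [indicator_of_notMem hv]
    refine (setLIntegral_congr_fun measurableSet_Ioo fun t ht => ?_).trans lintegral_zero
    simp only [hH]
    refine indicator_of_notMem (fun hq => hv (hmemS.2 ⟨hq.1.trans_le ?_, hq.2⟩)) _
    exact mul_le_of_le_one_left hh.le ht.2.le

/-! ### The additive inequality -/

lemma enorm_integral_translate_sub_le (hK : IsNormBody K) (hCo : IsOpen (C : Set (E d)))
    {f : E d → ℝ} {G : E d → E d}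
    (hG : IsWeakGradient (C : Set (E d)) f G) (hf : LocallyIntegrableOn f (C : Set (E d)) volume)
    {ψ : E d → ℝ} (hψ : ContDiff ℝ (⊤ : ℕ∞) ψ) (hc : HasCompactSupport ψ)
    (hs : tsupport ψ ⊆ C) (hψ0 : ∀ x, 0 ≤ ψ x) {u : E d} (hu : u ∈ (C : Set (E d))) :
    ‖∫ x in C, f x * (ψ (x - u) - ψ x)‖ₑ ≤
      ∫⁻ t in Ioo (0 : ℝ) 1, ∫⁻ x, ENNReal.ofReal (ψ x) *
        (ENNReal.ofReal (gauge K u) * ENNReal.ofReal (dualNorm K (G (x + t • u)))) := by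
  rw [hG.integral_mul_translate_sub hCo hf hψ hc hs hu,
    ← Measure.restrict_congr_set (Ioo_ae_eq_Ioc (μ := volume) (a := (0 : ℝ)) (b := 1))]
  refine (enorm_integral_le_lintegral_enorm _).trans (lintegral_mono fun t => ?_)
  refine (enorm_integral_le_lintegral_enorm _).trans ?_
  refine (setLIntegral_le_lintegral _ _).trans ?_
  rw [← lintegral_add_right_eq_self _ (t • u)]
  refine lintegral_mono fun x => ?_
  simp only [add_sub_cancel_right]
  rw [enorm_mul, mul_comm, Real.enorm_of_nonneg (hψ0 x), ← ENNReal.ofReal_mul (gauge_nonneg _),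
    Real.enorm_eq_ofReal_abs]
  gcongr
  exact hK.abs_inner_le _ _

/-- The pointwise form of the additive inequality for averages of `f` against test functions. -/
lemma ofReal_mul_enorm_integral_test_le (hd : 1 ≤ d) (hK : IsNormBody K)
    (hCo : IsOpen (C : Set (E d))) (hCn : (C : Set (E d)).Nonempty) {f : E d → ℝ}
    {G : E d → E d} (hG : IsWeakGradient (C : Set (E d)) f G) (hGm : Measurable G)
    (hf : LocallyIntegrableOn f (C : Set (E d)) volume)
    {ψ : E d → ℝ} (hψ : ContDiff ℝ (⊤ : ℕ∞) ψ) (hc : HasCompactSupport ψ)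
    (hs : tsupport ψ ⊆ C) (hψ0 : ∀ x, 0 ≤ ψ x) {h : ℝ} (hh : 0 < h) {M : ℝ≥0∞}
    (hM : ∀ x ∈ (C : Set (E d)), ∫⁻ v in (h • K) ∩ (C : Set (E d)),
        ENNReal.ofReal (g K C h (gauge K v)) * ENNReal.ofReal (dualNorm K (G (x + v))) ≤ M) :
    ENNReal.ofReal (h ^ d * vol K C) * ‖∫ x in C, f x * ψ x‖ₑ ≤
      (seminormAt K C h f + ENNReal.ofReal (h ^ d * vol K C) * M) *
        ∫⁻ x, ENNReal.ofReal (ψ x) := by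
  have hv := vol_pos hK hCo hCn
  have hCm : MeasurableSet (C : Set (E d)) := hCo.measurableSet
  set S := (h • K) ∩ (C : Set (E d)) with hS
  have hSm : MeasurableSet S := (isOpen_smul_inter hK hCo hh).measurableSet
  have hSC : S ⊆ C := inter_subset_right
  have hfin : IsFiniteMeasure (volume.restrict S) :=
    ⟨by rw [Measure.restrict_apply_univ]; exact (isBounded_smul_inter hK C h).measure_lt_top⟩
  -- all the points `x + u` stay in a compact subset `T` of the cone
  set T : Set (E d) := tsupport ψ + closure S
  have hTc : IsCompact T := hc.isCompact.add (isBounded_smul_inter hK C h).isCompact_closure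
  have hTC : T ⊆ C := by
    rintro _ ⟨x, hx, u, hu, rfl⟩
    exact add_mem_cone_of_mem_closure hCo (hs hx) (closure_mono hSC hu)
  have hmemT : ∀ {x u : E d}, x ∈ tsupport ψ → u ∈ S → u + x ∈ T := fun {x u} hx hu => by
    rw [add_comm]; exact add_mem_add hx (subset_closure hu)
  have hψs : ∀ {x : E d}, ψ x ≠ 0 → x ∈ tsupport ψ := fun {x} hx => subset_tsupport ψ hx
  set f0 : E d → ℝ := T.indicator f with hf0
  have hf0i : Integrable f0 volume :=
    (integrable_indicator_iff hTc.measurableSet).2 (hf.integrableOn_compact_subset hTC hTc)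
  obtain ⟨B, hB⟩ := hψ.continuous.bounded_above_of_compact_support hc
  have hint : Integrable (Function.uncurry fun (u x : E d) => f0 (u + x) * ψ x)
      ((volume.restrict S).prod volume) := by
    have h1 : Integrable (fun z : E d × E d => (1 : ℝ) * f0 z.2)
        ((volume.restrict S).prod volume) :=
      Integrable.mul_prod (f := fun _ : E d => (1 : ℝ)) (integrable_const _) hf0i
    simp only [one_mul] at h1
    have h2 := (measurePreserving_prod_add (volume.restrict S)
      (volume : Measure (E d))).integrable_comp_of_integrable h1
    refine Integrable.mul_bdd (c := B) h2 ?_ (ae_of_all _ fun z => hB _)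
    exact (hψ.continuous.comp continuous_snd).aestronglyMeasurable
  have hshift : ∀ u ∈ S, ∫ x in C, f x * ψ (x - u) = ∫ x, f0 (u + x) * ψ x := by
    intro u hu
    rw [← integral_indicator hCm, ← integral_add_left_eq_self _ u]
    refine integral_congr_ae (ae_of_all _ fun x => ?_)
    by_cases hx : ψ x = 0
    · simp [indicator, hx]
    · simp only
      rw [indicator_of_mem (hTC (hmemT (hψs hx) hu)), hf0, indicator_of_mem (hmemT (hψs hx) hu),
        add_sub_cancel_left]
  -- the mean value of the translated averages
  have hmean : ‖∫ u in S, ∫ x, f0 (u + x) * ψ x‖ₑ ≤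
      seminormAt K C h f * ∫⁻ x, ENNReal.ofReal (ψ x) := by
    rw [integral_integral_swap hint,
      ← lintegral_const_mul _ hψ.continuous.measurable.ennreal_ofReal]
    refine (enorm_integral_le_lintegral_enorm _).trans (lintegral_mono fun x => ?_)
    rw [integral_mul_const, enorm_mul, Real.enorm_of_nonneg (hψ0 x)]
    rcases eq_or_ne (ψ x) 0 with hx | hx
    · simp [hx]
    gcongr
    have : ∫ u in S, f0 (u + x) = ∫ u in S, f (x + u) := by
      refine setIntegral_congr_fun hSm fun u hu => ?_
      rw [hf0, indicator_of_mem (hmemT (hψs hx) hu), add_comm]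
    rw [this]
    exact le_iSup₂_of_le x (hs (hψs hx)) le_rfl
  have hdiff : ∫⁻ u in S, ‖∫ x in C, f x * (ψ (x - u) - ψ x)‖ₑ ≤
      ENNReal.ofReal (h ^ d * vol K C) * M * ∫⁻ x, ENNReal.ofReal (ψ x) := by
    have hNm : Measurable fun x => ENNReal.ofReal (dualNorm K (G x)) :=
      (hK.continuous_dualNorm.measurable.comp hGm).ennreal_ofReal
    have hψm : Measurable ψ := hψ.continuous.measurable
    have hgm : Measurable (gauge K) := hK.continuous_gauge.measurable
    calc ∫⁻ u in S, ‖∫ x in C, f x * (ψ (x - u) - ψ x)‖ₑ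
        ≤ ∫⁻ u in S, ∫⁻ t in Ioo (0 : ℝ) 1, ∫⁻ x, ENNReal.ofReal (ψ x) *
          (ENNReal.ofReal (gauge K u) * ENNReal.ofReal (dualNorm K (G (x + t • u)))) :=
          setLIntegral_mono' hSm fun u hu =>
            enorm_integral_translate_sub_le hK hCo hG hf hψ hc hs hψ0 (hSC hu)
      _ = ∫⁻ u in S, ∫⁻ x, ∫⁻ t in Ioo (0 : ℝ) 1, ENNReal.ofReal (ψ x) *
          (ENNReal.ofReal (gauge K u) * ENNReal.ofReal (dualNorm K (G (x + t • u)))) := by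
          refine lintegral_congr fun u => lintegral_lintegral_swap ?_
          refine Measurable.aemeasurable (Measurable.mul (by fun_prop) (Measurable.mul
            measurable_const (hNm.comp (by fun_prop : Measurable fun q : ℝ × E d =>
              q.2 + q.1 • u))))
      _ = ∫⁻ x, ∫⁻ u in S, ∫⁻ t in Ioo (0 : ℝ) 1, ENNReal.ofReal (ψ x) *
          (ENNReal.ofReal (gauge K u) * ENNReal.ofReal (dualNorm K (G (x + t • u)))) := by
          refine lintegral_lintegral_swap (Measurable.aemeasurable ?_)
          refine Measurable.lintegral_prod_right' (f := fun q : (E d × E d) × ℝ =>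
            ENNReal.ofReal (ψ q.1.2) * (ENNReal.ofReal (gauge K q.1.1) *
              ENNReal.ofReal (dualNorm K (G (q.1.2 + q.2 • q.1.1))))) ?_
          exact Measurable.mul (by fun_prop) (Measurable.mul (by fun_prop)
            (hNm.comp (by fun_prop : Measurable fun q : (E d × E d) × ℝ =>
              q.1.2 + q.2 • q.1.1)))
      _ ≤ ∫⁻ x, ENNReal.ofReal (h ^ d * vol K C) * M * ENNReal.ofReal (ψ x) := by
          refine lintegral_mono fun x => ?_
          rcases eq_or_ne (ψ x) 0 with hx | hx
          · simp [hx]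
          have hNx : Measurable fun v => ENNReal.ofReal (dualNorm K (G (x + v))) :=
            hNm.comp (measurable_const_add x)
          have h1 : ∀ u, ∫⁻ t in Ioo (0 : ℝ) 1, ENNReal.ofReal (ψ x) *
              (ENNReal.ofReal (gauge K u) * ENNReal.ofReal (dualNorm K (G (x + t • u)))) =
              ENNReal.ofReal (ψ x) * ∫⁻ t in Ioo (0 : ℝ) 1,
              (ENNReal.ofReal (gauge K u) * ENNReal.ofReal (dualNorm K (G (x + t • u)))) :=
            fun u => lintegral_const_mul' _ _ ENNReal.ofReal_ne_top
          simp only [h1]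
          rw [lintegral_const_mul' _ _ ENNReal.ofReal_ne_top,
            lintegral_segment hd hK hCo hCn hh hNx, mul_comm]
          gcongr
          exact hM x (hs (hψs hx))
      _ = _ := lintegral_const_mul _ (by fun_prop)
  -- `f` at the vertex equals the mean value minus the mean increment
  have hvolS : volume.real S = h ^ d * vol K C := by
    rw [Measure.real, hS, volume_smul_inter hK hh, ENNReal.toReal_ofReal (by positivity)]
  have hid : (h ^ d * vol K C) * ∫ x in C, f x * ψ x =
      (∫ u in S, ∫ x, f0 (u + x) * ψ x) - ∫ u in S, ∫ x in C, f x * (ψ (x - u) - ψ x) := by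
    have e1 : ∀ u ∈ S, ∫ x in C, f x * (ψ (x - u) - ψ x) =
        (∫ x, f0 (u + x) * ψ x) - ∫ x in C, f x * ψ x := by
      intro u hu
      rw [← hshift u hu]
      simp_rw [mul_sub]
      refine integral_sub ?_ (integrable_mul_of_tsupport_subset hf hψ.continuous hc hs).restrict
      have htr : (fun x => ψ (x - u)) = ψ ∘ Homeomorph.addRight (-u) := by
        ext x; simp [sub_eq_add_neg]
      refine (integrable_mul_of_tsupport_subset (φ := fun x => ψ (x - u)) hf ?_ ?_ ?_).restrict
      · exact hψ.continuous.comp (continuous_id.sub continuous_const)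
      · rw [htr]; exact hc.comp_homeomorph _
      · rw [htr, tsupport_comp_eq_preimage]
        intro x hx
        have := hTC (hmemT hx hu)
        simpa [sub_eq_add_neg] using this
    have hi1 : Integrable (fun u => ∫ x, f0 (u + x) * ψ x) (volume.restrict S) :=
      hint.integral_prod_left
    rw [setIntegral_congr_fun hSm e1, integral_sub hi1 (integrable_const _), setIntegral_const,
      hvolS, smul_eq_mul]
    ring
  calc ENNReal.ofReal (h ^ d * vol K C) * ‖∫ x in C, f x * ψ x‖ₑ
      = ‖(h ^ d * vol K C) * ∫ x in C, f x * ψ x‖ₑ := by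
        rw [enorm_mul, Real.enorm_of_nonneg (mul_nonneg (pow_nonneg hh.le d) hv.le)]
    _ ≤ ‖∫ u in S, ∫ x, f0 (u + x) * ψ x‖ₑ + ∫⁻ u in S, ‖∫ x in C, f x * (ψ (x - u) - ψ x)‖ₑ := by
        rw [hid]
        refine enorm_sub_le.trans ?_
        gcongr
        exact enorm_integral_le_lintegral_enorm _
    _ ≤ _ := by
        rw [add_mul]
        exact add_le_add hmean hdiff

/-- A function whose averages against all nonnegative test functions are bounded by `M` times
their mass is bounded by `M` almost everywhere. -/
lemma ae_abs_le_of_forall_test {Q : Set (E d)} (hQ : IsOpen Q) {f : E d → ℝ}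
    (hf : LocallyIntegrableOn f Q volume) {M : ℝ}
    (hM : ∀ ψ : E d → ℝ, ContDiff ℝ (⊤ : ℕ∞) ψ → HasCompactSupport ψ → tsupport ψ ⊆ Q →
      (∀ x, 0 ≤ ψ x) → |∫ x in Q, f x * ψ x| ≤ M * ∫ x, ψ x) :
    ∀ᵐ x ∂(volume.restrict Q), |f x| ≤ M := by
  rw [ae_restrict_iff' hQ.measurableSet, ae_iff]
  refine measure_null_of_locally_null _ fun x₀ hx₀ => ?_
  have hx₀Q : x₀ ∈ Q := by
    by_contra h
    exact hx₀ fun h' => absurd h' h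
  obtain ⟨r, hr, hrQ⟩ := Metric.nhds_basis_closedBall.mem_iff.1 (hQ.mem_nhds hx₀Q)
  set f0 : E d → ℝ := (Metric.closedBall x₀ r).indicator f with hf0
  have hBc : IsCompact (Metric.closedBall x₀ r) := isCompact_closedBall x₀ r
  have hf0i : Integrable f0 volume :=
    (integrable_indicator_iff hBc.measurableSet).2 (hf.integrableOn_compact_subset hrQ hBc)
  let φ : ℕ → ContDiffBump (0 : E d) := fun n =>
    ⟨1 / (2 * ((n : ℝ) + 1)), 1 / ((n : ℝ) + 1), by positivity, by
      apply one_div_lt_one_div_of_lt (by positivity); nlinarith [n.cast_nonneg (α := ℝ)]⟩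
  have hφ0 : Tendsto (fun n => (φ n).rOut) atTop (𝓝 0) :=
    tendsto_one_div_add_atTop_nhds_zero_nat
  have hφK : ∀ᶠ n in atTop, (φ n).rOut ≤ 2 * (φ n).rIn := by
    refine Eventually.of_forall fun n => le_of_eq ?_
    change 1 / ((n : ℝ) + 1) = 2 * (1 / (2 * ((n : ℝ) + 1)))
    field_simp
  have hlim := ContDiffBump.ae_convolution_tendsto_right_of_locallyIntegrable (μ := volume)
    hφ0 hφK hf0i.locallyIntegrable
  refine ⟨_, inter_mem_nhdsWithin _ (Metric.ball_mem_nhds x₀ hr), ?_⟩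
  have : ∀ᵐ x : E d, ¬ (x ∈ Metric.ball x₀ r ∧ ¬ |f x| ≤ M) := by
    filter_upwards [hlim] with x hx
    rintro ⟨hxB, hxM⟩
    have hfx : f0 x = f x := indicator_of_mem (Metric.ball_subset_closedBall hxB) f
    rw [hfx] at hx
    refine hxM (le_of_tendsto hx.abs ?_)
    have hpos : 0 < r - dist x x₀ := sub_pos.2 hxB
    filter_upwards [(tendsto_order.1 hφ0).2 _ hpos] with n hn
    set ψ : E d → ℝ := fun y => (φ n).normed volume (x - y) with hψ
    have hψe : ψ = (φ n).normed volume ∘ Homeomorph.subLeft x := rfl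
    have hsupp : tsupport ψ ⊆ Metric.closedBall x₀ r := by
      rw [hψe, tsupport_comp_eq_preimage, ContDiffBump.tsupport_normed_eq]
      intro y hy
      have hy' : ‖x - y‖ ≤ (φ n).rOut := by simpa using hy
      rw [Metric.mem_closedBall]
      have h1 := dist_triangle y x x₀
      rw [dist_comm y x, dist_eq_norm x y] at h1
      linarith
    have h1 := hM ψ ((φ n).contDiff_normed.comp (contDiff_const.sub contDiff_id))
      (by rw [hψe]; exact (φ n).hasCompactSupport_normed.comp_homeomorph _) (hsupp.trans hrQ)
      (fun y => (φ n).nonneg_normed _)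
    have h2 : ∫ y, ψ y = 1 := by
      rw [hψ, integral_sub_left_eq_self (fun y => (φ n).normed volume y) volume x]
      exact (φ n).integral_normed
    rw [h2, mul_one] at h1
    refine le_trans (le_of_eq ?_) h1
    congr 1
    rw [convolution_eq_swap, ← integral_indicator hQ.measurableSet]
    refine integral_congr_ae (ae_of_all _ fun y => ?_)
    simp only [ContinuousLinearMap.lsmul_apply, smul_eq_mul]
    by_cases hy : y ∈ Metric.closedBall x₀ r
    · rw [indicator_of_mem (hrQ hy), hf0, indicator_of_mem hy, mul_comm]
    · have : ψ y = 0 := image_eq_zero_of_notMem_tsupport fun h => hy (hsupp h)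
      rw [hf0, indicator_of_notMem hy, mul_zero]
      simp [indicator, this]
  refine measure_mono_null (fun x hx => ?_) (ae_iff.1 this)
  obtain ⟨hx1, hx2⟩ := hx
  have hx1 : ¬ (x ∈ Q → |f x| ≤ M) := hx1
  exact fun h => h ⟨hx2, fun h' => hx1 fun _ => h'⟩

lemma IsWeakGradient.congr {Q : Set (E d)} (hQ : IsOpen Q) {f : E d → ℝ} {G G' : E d → E d}
    (hG : IsWeakGradient Q f G) (h : G =ᵐ[volume.restrict Q] G') : IsWeakGradient Q f G' := by
  refine ⟨fun i => ?_, fun φ hφ hc hs i => ?_⟩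
  · rw [locallyIntegrableOn_iff hQ.isLocallyClosed]
    intro k hk hkc
    refine ((hG.1 i).integrableOn_compact_subset hk hkc).congr ?_
    filter_upwards [ae_restrict_of_ae_restrict_of_subset hk h] with x hx
    rw [hx]
  · rw [hG.2 φ hφ hc hs i]
    congr 1
    refine integral_congr_ae ?_
    filter_upwards [h] with x hx
    rw [hx]

lemma IsWeakGradient.aemeasurable {Q : Set (E d)} {f : E d → ℝ} {G : E d → E d}
    (hG : IsWeakGradient Q f G) : AEMeasurable G (volume.restrict Q) := by
  have h1 : AEMeasurable (fun x i => G x i) (volume.restrict Q) :=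
    aemeasurable_pi_iff.2 fun i => (hG.1 i).aestronglyMeasurable.aemeasurable
  exact (MeasurableEquiv.toLp 2 (Fin d → ℝ)).measurable.comp_aemeasurable h1

lemma isWeakGradient_weakGradient {Q : Set (E d)} {f : E d → ℝ}
    (h : ∃ G, IsWeakGradient Q f G) : IsWeakGradient Q f (weakGradient Q f) := by
  rw [weakGradient, dif_pos h]
  exact h.choose_spec

lemma lintegral_g_mul_le (hK : IsNormBody K) (hCo : IsOpen (C : Set (E d))) {p : ℝ≥0∞}
    (hp : 1 ≤ p) {h : ℝ} {G : E d → E d} (hGm : Measurable G) {x : E d}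
    (hx : x ∈ (C : Set (E d))) :
    ∫⁻ v in (h • K) ∩ (C : Set (E d)),
        ENNReal.ofReal (g K C h (gauge K v)) * ENNReal.ofReal (dualNorm K (G (x + v))) ≤
      gNorm K C p h * eLpNorm (fun x => dualNorm K (G x)) p (volume.restrict (C : Set (E d))) := by
  have hCm : MeasurableSet (C : Set (E d)) := hCo.measurableSet
  have hNm : Measurable fun x => dualNorm K (G x) := hK.continuous_dualNorm.measurable.comp hGm
  have hgm : Measurable fun v => g K C h (gauge K v) :=
    (measurable_g K C h).comp hK.continuous_gauge.measurable
  have hHC : ENNReal.HolderConjugate p (ENNReal.conjExponent p) := .conjExponent hp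
  set S := (h • K) ∩ (C : Set (E d)) with hS
  have hNx : Measurable fun v => dualNorm K (G (x + v)) := hNm.comp (measurable_const_add x)
  have h1 := eLpNorm_smul_le_mul_eLpNorm (p := ENNReal.conjExponent p) (q := p) (r := 1)
    (μ := volume.restrict S) hNx.aestronglyMeasurable hgm.aestronglyMeasurable
  have h2 : eLpNorm (fun v => dualNorm K (G (x + v))) p (volume.restrict S) ≤
      eLpNorm (fun x => dualNorm K (G x)) p (volume.restrict (C : Set (E d))) := by
    have hmp := (measurePreserving_add_left (volume : Measure (E d)) x).restrict_preimage hCm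
    rw [← eLpNorm_comp_measurePreserving hNm.aestronglyMeasurable hmp]
    refine eLpNorm_mono_measure _ (Measure.restrict_mono (fun v hv => ?_) le_rfl)
    exact add_mem_cone hx hv.2
  refine le_trans ?_ (h1.trans (mul_le_mul_right h2 _))
  rw [eLpNorm_one_eq_lintegral_enorm]
  refine lintegral_mono fun v => ?_
  rw [Pi.smul_apply', smul_eq_mul, enorm_mul]
  exact mul_le_mul' (Real.ofReal_le_enorm _) (Real.ofReal_le_enorm _)

lemma avgConst_eq (hK : IsNormBody K) (hCo : IsOpen (C : Set (E d)))
    (hCn : (C : Set (E d)).Nonempty) {h : ℝ} (hh : 0 < h) :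
    avgConst K C h = (ENNReal.ofReal (h ^ d * vol K C))⁻¹ := by
  have hv := vol_pos hK hCo hCn
  rw [avgConst, ← ENNReal.ofReal_inv_of_pos (by positivity), mul_inv, mul_comm]

/-- The additive inequality; no finiteness of the seminorm is needed in this form. -/
theorem supNorm_le_gNorm_mul_add (hd : 1 ≤ d) (hK : IsNormBody K)
    (hCo : IsOpen (C : Set (E d))) (hCn : (C : Set (E d)).Nonempty) {p : ℝ≥0∞} (hp : 1 ≤ p)
    {f : E d → ℝ} (hf : MemW (C : Set (E d)) p f) {h : ℝ} (hh : 0 < h) :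
    supNorm C f ≤ gNorm K C p h * gradNorm K C p f + avgConst K C h * seminormAt K C h f := by
  have hv := vol_pos hK hCo hCn
  obtain ⟨hfl, hex, -⟩ := hf
  have hw := isWeakGradient_weakGradient hex
  set G := hw.aemeasurable.mk
  have hGae : weakGradient (C : Set (E d)) f =ᵐ[volume.restrict (C : Set (E d))] G :=
    hw.aemeasurable.ae_eq_mk
  have hGm : Measurable G := hw.aemeasurable.measurable_mk
  have hG := hw.congr hCo hGae
  have hgrad : gradNorm K C p f =
      eLpNorm (fun x => dualNorm K (G x)) p (volume.restrict (C : Set (E d))) := by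
    refine eLpNorm_congr_ae ?_
    filter_upwards [hGae] with x hx
    rw [hx]
  set R := gNorm K C p h * gradNorm K C p f + avgConst K C h * seminormAt K C h f with hR
  rcases eq_or_ne R ∞ with hRtop | hRtop
  · rw [hRtop]; exact le_top
  set V := ENNReal.ofReal (h ^ d * vol K C) with hV
  have hV0 : V ≠ 0 := by
    rw [hV, Ne, ENNReal.ofReal_eq_zero, not_le]; positivity
  have hVt : V ≠ ∞ := ENNReal.ofReal_ne_top
  have key : ∀ᵐ x ∂(volume.restrict (C : Set (E d))), |f x| ≤ R.toReal := by
    refine ae_abs_le_of_forall_test hCo hfl fun ψ hψ hc hs hψ0 => ?_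
    have h1 := ofReal_mul_enorm_integral_test_le hd hK hCo hCn hG hGm hfl hψ hc hs hψ0 hh
      (fun x hx => lintegral_g_mul_le hK hCo hp hGm hx)
    rw [← hgrad, ← hV] at h1
    have h2 : ‖∫ x in C, f x * ψ x‖ₑ ≤ R * ∫⁻ x, ENNReal.ofReal (ψ x) := by
      rw [← ENNReal.mul_le_mul_iff_right hV0 hVt, ← mul_assoc]
      refine h1.trans (le_of_eq ?_)
      rw [hR, avgConst_eq hK hCo hCn hh, mul_add, ← mul_assoc V V⁻¹,
        ENNReal.mul_inv_cancel hV0 hVt, one_mul, add_comm]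
    have hψi : Integrable ψ volume := hψ.continuous.integrable_of_hasCompactSupport hc
    rw [← ofReal_integral_eq_lintegral_ofReal hψi (ae_of_all _ hψ0),
      ← ENNReal.ofReal_toReal hRtop, ← ENNReal.ofReal_mul ENNReal.toReal_nonneg,
      Real.enorm_eq_ofReal_abs] at h2
    exact (ENNReal.ofReal_le_ofReal_iff
      (mul_nonneg ENNReal.toReal_nonneg (integral_nonneg hψ0))).1 h2
  rw [supNorm, eLpNorm_exponent_top]
  refine eLpNormEssSup_le_of_ae_enorm_bound ?_
  filter_upwards [key] with x hx
  rw [Real.enorm_eq_ofReal_abs]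
  exact ENNReal.ofReal_le_of_le_toReal hx

/-! ### Weak gradients of radial functions -/

/-- The primitive `r ↦ ∫_r^h k` of `-k` that vanishes on `[h, ∞)`. -/
noncomputable def radialPrimitive (k : ℝ → ℝ) (h r : ℝ) : ℝ := ∫ u in (min r h)..h, k u

/-- The gradient of `x ↦ ∫_{|x|_K}^h k` (for `|x|_K < h`), extended by `0`: it is
`-k(|x|_K) ∇|x|_K` wherever the norm is differentiable. -/
noncomputable def radialGradient (K : Set (E d)) (k : ℝ → ℝ) (h : ℝ) (x : E d) : E d :=
  (-(Iio h).indicator k (gauge K x)) • gradient (gauge K) x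

lemma radialPrimitive_of_le {k : ℝ → ℝ} {h r : ℝ} (hr : h ≤ r) : radialPrimitive k h r = 0 := by
  rw [radialPrimitive, min_eq_right hr, intervalIntegral.integral_same]

section Radial

variable {k : ℝ → ℝ} {h : ℝ}

lemma intervalIntegrable_of_integrableOn_Ioo (hh : 0 < h) (hki : IntegrableOn k (Ioo 0 h))
    {a b : ℝ} (ha : a ∈ Icc 0 h) (hb : b ∈ Icc 0 h) : IntervalIntegrable k volume a b := by
  have h1 : IntervalIntegrable k volume 0 h :=
    (intervalIntegrable_iff_integrableOn_Ioo_of_le hh.le).2 hki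
  refine h1.mono_set ?_
  rw [uIcc_of_le hh.le]
  exact (convex_Icc 0 h).ordConnected.uIcc_subset ha hb

lemma continuousOn_radialPrimitive (hh : 0 < h) (hki : IntegrableOn k (Ioo 0 h)) :
    ContinuousOn (radialPrimitive k h) (Ici 0) := by
  have h1 : ContinuousOn (fun r => ∫ u in r..h, k u) (uIcc 0 h) := by
    have := intervalIntegral.continuousOn_primitive_interval_left (μ := volume) (f := k)
      (a := 0) (b := h) ?_
    · exact this
    · rw [uIcc_of_le hh.le, integrableOn_Icc_iff_integrableOn_Ioo]
      exact hki
  refine h1.comp (f := fun r => min r h) (by fun_prop) fun r hr => ?_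
  rw [uIcc_of_le hh.le]
  exact ⟨le_min hr hh.le, min_le_right _ _⟩

lemma abs_radialPrimitive_le (hh : 0 < h) (hki : IntegrableOn k (Ioo 0 h)) {r : ℝ} (hr : 0 ≤ r) :
    |radialPrimitive k h r| ≤ ∫ u in Ioo 0 h, |k u| := by
  have h1 : min r h ≤ h := min_le_right _ _
  rw [radialPrimitive, ← integral_Ioc_eq_integral_Ioo]
  refine (intervalIntegral.abs_integral_le_integral_abs h1).trans ?_
  rw [intervalIntegral.integral_of_le h1]
  refine setIntegral_mono_set ?_ (ae_of_all _ fun u => abs_nonneg _)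
    (Ioc_subset_Ioc_left (le_min hr hh.le)).eventuallyLE
  exact ((integrableOn_Ioc_iff_integrableOn_Ioo (by simp)).2 hki).abs

lemma exists_lipschitz_radialPrimitive_max (hh : 0 < h) (hkc : ContinuousOn k (Ioc 0 h))
    (hki : IntegrableOn k (Ioo 0 h)) {δ : ℝ} (hδ : 0 < δ) :
    ∃ B, LipschitzWith B fun r => radialPrimitive k h (max r δ) := by
  rcases lt_or_ge h δ with hhδ | hδh
  · refine ⟨0, LipschitzWith.of_dist_le_mul fun r s => ?_⟩
    rw [radialPrimitive_of_le (hhδ.le.trans (le_max_right r δ)),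
      radialPrimitive_of_le (hhδ.le.trans (le_max_right s δ))]
    simp
  obtain ⟨B, hB⟩ := isCompact_Icc.exists_bound_of_continuousOn
    (hkc.mono fun u (hu : u ∈ Icc δ h) => ⟨hδ.trans_le hu.1, hu.2⟩)
  have hB0 : 0 ≤ B := (norm_nonneg _).trans (hB δ ⟨le_rfl, hδh⟩)
  refine ⟨⟨B, hB0⟩, LipschitzWith.of_dist_le_mul fun r s => ?_⟩
  have hmem : ∀ r : ℝ, min (max r δ) h ∈ Icc δ h := fun r =>
    ⟨le_min (le_max_right _ _) hδh, min_le_right _ _⟩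
  have hmem' : ∀ r : ℝ, min (max r δ) h ∈ Icc 0 h := fun r => ⟨hδ.le.trans (hmem r).1, (hmem r).2⟩
  have hadd := intervalIntegral.integral_add_adjacent_intervals
    (intervalIntegrable_of_integrableOn_Ioo hh hki (hmem' r) (hmem' s))
    (intervalIntegrable_of_integrableOn_Ioo hh hki (hmem' s) ⟨hh.le, le_rfl⟩)
  rw [Real.dist_eq, Real.dist_eq, radialPrimitive, radialPrimitive, ← hadd, add_sub_cancel_right]
  refine (intervalIntegral.norm_integral_le_of_norm_le_const fun u hu => hB u ?_).trans ?_
  · exact (convex_Icc δ h).ordConnected.uIcc_subset (hmem r) (hmem s) (uIoc_subset_uIcc hu)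
  · refine mul_le_mul_of_nonneg_left ?_ hB0
    rw [abs_sub_comm]
    exact (abs_inf_sub_inf_le_abs _ _ _).trans (abs_sup_sub_sup_le_abs _ _ _)

/-- Away from the vertex and the boundary of `hK` a truncated radial function has the expected
derivative. -/
lemma hasFDerivAt_radialPrimitive_max (hK : IsNormBody K) (hh : 0 < h)
    (hkc : ContinuousOn k (Ioc 0 h)) (hki : IntegrableOn k (Ioo 0 h)) {δ : ℝ} (hδ : 0 < δ)
    {y : E d} (hy : DifferentiableAt ℝ (gauge K) y) (hyδ : gauge K y ≠ δ) (hyh : gauge K y ≠ h) :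
    HasFDerivAt (fun y => radialPrimitive k h (max (gauge K y) δ))
      ((if δ < gauge K y then -(Iio h).indicator k (gauge K y) else 0) •
        fderiv ℝ (gauge K) y) y := by
  have hcont := hK.continuous_gauge
  rcases hyδ.lt_or_gt with h1 | h1
  · rw [if_neg h1.not_gt, zero_smul]
    refine (hasFDerivAt_const (radialPrimitive k h δ) y).congr_of_eventuallyEq ?_
    filter_upwards [(hcont.tendsto y).eventually (gt_mem_nhds h1)] with z hz
    rw [max_eq_right hz.le]
  · rw [if_pos h1]
    rcases hyh.lt_or_gt with h2 | h2
    · rw [indicator_of_mem (show gauge K y ∈ Iio h from h2)]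
      have hpos : 0 < gauge K y := hδ.trans h1
      have hd : HasDerivAt (fun r => ∫ u in r..h, k u) (-k (gauge K y)) (gauge K y) := by
        refine intervalIntegral.integral_hasDerivAt_left
          (intervalIntegrable_of_integrableOn_Ioo hh hki ⟨hpos.le, h2.le⟩ ⟨hh.le, le_rfl⟩) ?_
          (hkc.continuousAt (Ioc_mem_nhds hpos h2))
        exact (hkc.mono Ioo_subset_Ioc_self).stronglyMeasurableAtFilter isOpen_Ioo _ ⟨hpos, h2⟩
      refine (hd.comp_hasFDerivAt y hy.hasFDerivAt).congr_of_eventuallyEq ?_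
      filter_upwards [(hcont.tendsto y).eventually (gt_mem_nhds h2),
        (hcont.tendsto y).eventually (lt_mem_nhds h1)] with z hz1 hz2
      rw [radialPrimitive, max_eq_left hz2.le, min_eq_left hz1.le]
      rfl
    · rw [indicator_of_notMem (show gauge K y ∉ Iio h from not_lt.2 h2.le), neg_zero, zero_smul]
      refine (hasFDerivAt_const (0 : ℝ) y).congr_of_eventuallyEq ?_
      filter_upwards [(hcont.tendsto y).eventually (lt_mem_nhds h2)] with z hz
      exact radialPrimitive_of_le (hz.le.trans (le_max_left _ _))

lemma ae_ne_gauge (hK : IsNormBody K) {r : ℝ} (hr : 0 < r) : ∀ᵐ y : E d, gauge K y ≠ r := by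
  rw [ae_iff]
  simpa using volume_gauge_eq hK hr

lemma ae_differentiableAt_gauge (hK : IsNormBody K) :
    ∀ᵐ y : E d, DifferentiableAt ℝ (gauge K) y := by
  obtain ⟨L, hL⟩ := hK.exists_lipschitz
  exact hL.ae_differentiableAt

lemma measurable_radialGradient (hK : IsNormBody K) (hkm : Measurable k) :
    Measurable (radialGradient K k h) := by
  have h1 : Measurable (gradient (gauge K)) :=
    (InnerProductSpace.toDual ℝ (E d)).symm.continuous.measurable.comp (measurable_fderiv ℝ _)
  exact ((hkm.indicator measurableSet_Iio).comp hK.continuous_gauge.measurable).neg.smul h1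

lemma integrable_radialGradient (hd : 1 ≤ d) (hK : IsNormBody K) (hh : 0 < h) (hkm : Measurable k)
    (hki : IntegrableOn k (Ioo 0 h)) : Integrable (radialGradient K k h) volume := by
  obtain ⟨L, hL⟩ := hK.exists_lipschitz
  have hrad : Integrable (fun x : E d => (Iio h).indicator k (gauge K x)) volume := by
    have hgm : Measurable (gauge K) := hK.continuous_gauge.measurable
    refine ⟨((hkm.indicator measurableSet_Iio).comp hgm).aestronglyMeasurable, ?_⟩
    have h1 := lintegral_radial (C := ⊤) hd hK (by simp) hh (F := fun u => ‖k u‖ₑ) (by fun_prop)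
    have h2 : ∫⁻ x : E d, ‖(Iio h).indicator k (gauge K x)‖ₑ =
        ∫⁻ x in (h • K) ∩ ((⊤ : ConvexCone ℝ (E d)) : Set (E d)), ‖k (gauge K x)‖ₑ := by
      rw [← lintegral_indicator (isOpen_smul_inter hK (by simp) hh).measurableSet]
      refine lintegral_congr fun x => ?_
      by_cases hx : gauge K x < h
      · have : x ∈ (h • K) ∩ ((⊤ : ConvexCone ℝ (E d)) : Set (E d)) :=
          ⟨(hK.mem_smul_iff hh).2 hx, by simp⟩
        rw [indicator_of_mem this, indicator_of_mem (show gauge K x ∈ Iio h from hx)]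
      · have : x ∉ (h • K) ∩ ((⊤ : ConvexCone ℝ (E d)) : Set (E d)) :=
          fun h' => hx ((hK.mem_smul_iff hh).1 h'.1)
        rw [indicator_of_notMem this, indicator_of_notMem (show gauge K x ∉ Iio h from hx)]
        simp
    rw [HasFiniteIntegral, h2, h1]
    refine ENNReal.mul_lt_top ENNReal.ofReal_lt_top ?_
    refine lt_of_le_of_lt (b := ∫⁻ u in Ioo 0 h, ‖k u‖ₑ * ENNReal.ofReal (h ^ (d - 1))) ?_ ?_
    · refine setLIntegral_mono' measurableSet_Ioo fun u hu => ?_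
      gcongr
      exacts [hu.1.le, hu.2.le]
    · rw [lintegral_mul_const _ (by fun_prop)]
      exact ENNReal.mul_lt_top hki.2 ENNReal.ofReal_lt_top
  refine (hrad.mul_const (L : ℝ)).mono (measurable_radialGradient hK hkm).aestronglyMeasurable
    (ae_of_all _ fun x => ?_)
  rw [radialGradient, norm_smul, norm_neg, norm_mul]
  refine mul_le_mul_of_nonneg_left ?_ (norm_nonneg _)
  rw [gradient, LinearIsometryEquiv.norm_map]
  exact (norm_fderiv_le_of_lipschitz ℝ hL).trans (le_abs_self _)

lemma inner_radialGradient (v x : E d) :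
    inner ℝ v (radialGradient K k h x) =
      (-(Iio h).indicator k (gauge K x)) * fderiv ℝ (gauge K) x v := by
  rw [radialGradient, inner_smul_right, real_inner_comm, gradient,
    InnerProductSpace.toDual_symm_apply]

/-- A radial function `∫_{|x|_K}^h k` with integrable profile `k` has the expected weak gradient,
although `k` may be singular at `0`: integrate by parts for the Lipschitz functions
`∫_{max(|x|_K, δ)}^h k` and let `δ → 0`. -/
lemma isWeakGradient_radial (hd : 1 ≤ d) (hK : IsNormBody K) {Q : Set (E d)} (hh : 0 < h)
    (hkm : Measurable k) (hkc : ContinuousOn k (Ioc 0 h))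
    (hki : IntegrableOn k (Ioo 0 h)) :
    IsWeakGradient Q (fun x => radialPrimitive k h (gauge K x)) (radialGradient K k h) := by
  have hcont := hK.continuous_gauge
  have hGi := integrable_radialGradient hd hK hh hkm hki
  have hGc : ∀ i, Integrable (fun x => radialGradient K k h x i) volume := fun i =>
    (EuclideanSpace.proj (𝕜 := ℝ) i : E d →L[ℝ] ℝ).integrable_comp hGi
  refine ⟨fun i => (hGc i).locallyIntegrable.locallyIntegrableOn Q, fun φ hφ hc hs i => ?_⟩
  set v : E d := EuclideanSpace.single i 1 with hv
  have hφ0 : ∀ x, x ∉ Q → φ x = 0 := fun x hx =>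
    image_eq_zero_of_notMem_tsupport fun h => hx (hs h)
  have hdφ0 : ∀ x, x ∉ Q → fderiv ℝ φ x v = 0 := fun x hx =>
    image_eq_zero_of_notMem_tsupport (f := fun x => fderiv ℝ φ x v)
      fun h => hx (hs (tsupport_fderiv_apply_subset ℝ v h))
  rw [setIntegral_eq_integral_of_forall_compl_eq_zero fun x hx => by rw [hdφ0 x hx, mul_zero],
    setIntegral_eq_integral_of_forall_compl_eq_zero fun x hx => by rw [hφ0 x hx, mul_zero]]
  have hdφ : Continuous fun x => fderiv ℝ φ x v :=
    (hφ.continuous_fderiv (by simp)).clm_apply continuous_const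
  have hdφi : Integrable (fun x => fderiv ℝ φ x v) volume :=
    hdφ.integrable_of_hasCompactSupport (hc.fderiv_apply ℝ v)
  obtain ⟨B, hB⟩ := hφ.continuous.bounded_above_of_compact_support hc
  obtain ⟨D, hD⟩ := ContDiff.lipschitzWith_of_hasCompactSupport hc hφ (by simp)
  let δ : ℕ → ℝ := fun n => 1 / ((n : ℝ) + 1)
  have hδ : ∀ n, 0 < δ n := fun n => by positivity
  have hδ0 : Tendsto δ atTop (𝓝 0) := tendsto_one_div_add_atTop_nhds_zero_nat
  have hGv : ∀ x, radialGradient K k h x i =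
      (-(Iio h).indicator k (gauge K x)) * fderiv ℝ (gauge K) x v := by
    intro x
    rw [← inner_radialGradient, hv, EuclideanSpace.inner_single_left]
    simp
  have hdist : ∀ᵐ x : E d, 0 < gauge K x := by
    have : ∀ᵐ x : E d, x ≠ 0 := by
      rw [ae_iff]
      simpa using volume_singleton_zero hd
    filter_upwards [this] with x hx using hK.gauge_pos.2 hx
  -- integration by parts for the truncated functions
  have hparts : ∀ n, ∫ x, radialPrimitive k h (max (gauge K x) (δ n)) * fderiv ℝ φ x v =
      -∫ x, (if δ n < gauge K x then radialGradient K k h x i else 0) * φ x := by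
    intro n
    obtain ⟨B', hB'⟩ := exists_lipschitz_radialPrimitive_max hh hkc hki (hδ n)
    obtain ⟨L, hL⟩ := hK.exists_lipschitz
    have h1 := (hB'.comp hL).integral_lineDeriv_mul_eq (μ := volume) hD hc v
    have h2 : ∫ x, lineDeriv ℝ ((fun r => radialPrimitive k h (max r (δ n))) ∘ gauge K) x v * φ x
        = ∫ x, (if δ n < gauge K x then radialGradient K k h x i else 0) * φ x := by
      refine integral_congr_ae ?_
      filter_upwards [ae_differentiableAt_gauge hK, ae_ne_gauge hK (hδ n), ae_ne_gauge hK hh]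
        with x hx1 hx2 hx3
      have h3 := (hasFDerivAt_radialPrimitive_max hK hh hkc hki (hδ n) hx1 hx2 hx3).hasLineDerivAt v
      have h4 : lineDeriv ℝ ((fun r => radialPrimitive k h (max r (δ n))) ∘ gauge K) x v = _ :=
        h3.lineDeriv
      rw [h4, hGv]
      split_ifs <;> simp
    have h5 : ∀ x, lineDeriv ℝ φ x (-v) = -fderiv ℝ φ x v := by
      intro x
      rw [((hφ.differentiable (by simp)).differentiableAt (x := x)).lineDeriv_eq_fderiv, map_neg]
    rw [← h2, h1, ← integral_neg]
    refine integral_congr_ae (ae_of_all _ fun x => ?_)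
    simp only [h5, Function.comp_apply]
    ring
  have hlim1 : Tendsto (fun n => ∫ x, radialPrimitive k h (max (gauge K x) (δ n)) * fderiv ℝ φ x v)
      atTop (𝓝 (∫ x, radialPrimitive k h (gauge K x) * fderiv ℝ φ x v)) := by
    refine tendsto_integral_of_dominated_convergence
      (fun x => (∫ u in Ioo 0 h, |k u|) * ‖fderiv ℝ φ x v‖) (fun n => ?_)
      (hdφi.norm.const_mul _) (fun n => ae_of_all _ fun x => ?_) ?_
    · refine Continuous.aestronglyMeasurable (Continuous.mul ?_ hdφ)
      exact (continuousOn_radialPrimitive hh hki).comp_continuous (by fun_prop)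
        fun x => (gauge_nonneg x).trans (le_max_left _ _)
    · rw [norm_mul, Real.norm_eq_abs]
      gcongr
      exact abs_radialPrimitive_le hh hki ((gauge_nonneg x).trans (le_max_left _ _))
    · filter_upwards [hdist] with x hx
      refine tendsto_const_nhds.congr' ?_
      filter_upwards [(tendsto_order.1 hδ0).2 _ hx] with n hn
      rw [max_eq_left hn.le]
  have hlim2 : Tendsto (fun n => ∫ x, (if δ n < gauge K x then radialGradient K k h x i else 0) *
      φ x) atTop (𝓝 (∫ x, radialGradient K k h x i * φ x)) := by
    refine tendsto_integral_of_dominated_convergence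
      (fun x => ‖radialGradient K k h x i‖ * B) (fun n => ?_)
      ((hGc i).norm.mul_const _) (fun n => ae_of_all _ fun x => ?_) ?_
    · refine AEStronglyMeasurable.mul ?_ hφ.continuous.aestronglyMeasurable
      have : (fun x => if δ n < gauge K x then radialGradient K k h x i else 0) =
          {x | δ n < gauge K x}.indicator fun x => radialGradient K k h x i := by
        ext x
        simp [indicator]
      rw [this]
      exact (hGc i).aestronglyMeasurable.indicator
        (measurableSet_lt measurable_const hcont.measurable)
    · rw [norm_mul]
      gcongr
      · split_ifs <;> simp
      · exact hB x
    · filter_upwards [hdist] with x hx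
      refine tendsto_const_nhds.congr' ?_
      filter_upwards [(tendsto_order.1 hδ0).2 _ hx] with n hn
      rw [if_pos hn]
  simp_rw [hparts] at hlim1
  exact tendsto_nhds_unique hlim1 hlim2.neg

end Radial

/-! ### Exponents -/

section Exponents

variable {p : ℝ≥0∞}

lemma one_lt_of_dim_lt (hd : 1 ≤ d) (hp : (d : ℝ≥0∞) < p) : 1 < p :=
  lt_of_le_of_lt (by exact_mod_cast hd) hp

lemma conjExponent_ne_top (hp : 1 < p) : ENNReal.conjExponent p ≠ ∞ := by
  rw [ENNReal.conjExponent]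
  exact ENNReal.add_ne_top.2 ⟨ENNReal.one_ne_top, ENNReal.inv_ne_top.2 (tsub_pos_of_lt hp).ne'⟩

lemma one_le_conjR (hp : 1 < p) : 1 ≤ conjR p := by
  rw [conjR, ← ENNReal.toReal_one]
  exact ENNReal.toReal_mono (conjExponent_ne_top hp) (by rw [ENNReal.conjExponent]; exact le_self_add)

/-- `1/p + 1/p' = 1`, where `p.toReal⁻¹ = 0` for `p = ∞`. -/
lemma inv_add_inv_conjR (hp : 1 < p) : p.toReal⁻¹ + (conjR p)⁻¹ = 1 := by
  have h := (ENNReal.HolderConjugate.conjExponent hp.le).inv_add_inv_eq_inv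
  have h2 := congrArg ENNReal.toReal h
  rwa [ENNReal.toReal_add (ENNReal.inv_ne_top.2 (zero_lt_one.trans hp).ne')
    (ENNReal.inv_ne_top.2 ?_), ENNReal.toReal_inv, ENNReal.toReal_inv, inv_one,
    ENNReal.toReal_one] at h2
  rw [ENNReal.conjExponent]
  exact (zero_lt_one.trans_le le_self_add).ne'

lemma conjR_eq_inv (hp : 1 < p) : conjR p = (1 - p.toReal⁻¹)⁻¹ := by
  rw [← inv_add_inv_conjR hp, add_sub_cancel_left, inv_inv]

lemma inv_toReal_lt (hd : 1 ≤ d) (hp : (d : ℝ≥0∞) < p) : p.toReal⁻¹ < (d : ℝ)⁻¹ := by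
  have hd0 : (0 : ℝ) < d := by exact_mod_cast hd
  rcases eq_or_ne p ∞ with rfl | h
  · simpa using (show 0 < d by omega)
  · refine inv_strictAnti₀ hd0 ?_
    have := (ENNReal.toReal_lt_toReal (by simp) h).2 hp
    simpa using this

/-- The condition `p > d` in terms of the dual exponent: the singularity of the profile
`g_h ^ (p' - 1)` at the origin is integrable. -/
lemma dim_sub_one_mul_conjR_lt (hd : 1 ≤ d) (hp : (d : ℝ≥0∞) < p) :
    ((d : ℝ) - 1) * (conjR p - 1) < 1 := by
  have hd0 : (1 : ℝ) ≤ d := by exact_mod_cast hd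
  have h1 := inv_toReal_lt hd hp
  have hp1 := one_lt_of_dim_lt hd hp
  have h2 := inv_add_inv_conjR hp1
  have h3 := one_le_conjR hp1
  have h4 : conjR p * (conjR p)⁻¹ = 1 := mul_inv_cancel₀ (by linarith)
  have h5 : (d : ℝ) * (d : ℝ)⁻¹ = 1 := mul_inv_cancel₀ (by linarith)
  set a := p.toReal⁻¹
  set b := (conjR p)⁻¹
  have h6 : conjR p * (1 - a) = 1 := by rw [show 1 - a = b by linarith]; exact h4
  have h7 : (d : ℝ) * a < 1 := by rw [← h5]; exact mul_lt_mul_of_pos_left h1 (by linarith)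
  nlinarith

end Exponents

/-! ### Uniqueness of weak gradients -/

lemma IsWeakGradient.ae_eq {Q : Set (E d)} (hQ : IsOpen Q) {f : E d → ℝ} {G G' : E d → E d}
    (hG : IsWeakGradient Q f G) (hG' : IsWeakGradient Q f G') : G =ᵐ[volume.restrict Q] G' := by
  have hi : ∀ i, ∀ᵐ x ∂(volume : Measure (E d)), x ∈ Q → G x i - G' x i = 0 := by
    intro i
    refine hQ.ae_eq_zero_of_integral_contDiff_smul_eq_zero ((hG.1 i).sub (hG'.1 i))
      fun φ hφ hc hs => ?_
    have h0 : ∀ x, x ∉ Q → φ x • (G x i - G' x i) = 0 := fun x hx => by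
      rw [image_eq_zero_of_notMem_tsupport fun h => hx (hs h), zero_smul]
    rw [← setIntegral_eq_integral_of_forall_compl_eq_zero h0]
    have h1 : ∀ x, φ x • (G x i - G' x i) = G x i * φ x - G' x i * φ x := fun x => by
      rw [smul_eq_mul]; ring
    simp_rw [h1]
    rw [integral_sub (integrable_mul_of_tsupport_subset (hG.1 i) hφ.continuous hc hs).restrict
      (integrable_mul_of_tsupport_subset (hG'.1 i) hφ.continuous hc hs).restrict, sub_eq_zero,
      ← neg_inj, ← hG.2 φ hφ hc hs i, ← hG'.2 φ hφ hc hs i]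
  rw [Filter.EventuallyEq, ae_restrict_iff' hQ.measurableSet]
  filter_upwards [ae_all_iff.2 hi] with x hx hxQ
  ext i
  exact sub_eq_zero.1 (hx i hxQ)

/-! ### The extremal function -/

/-- The radial profile `g_h ^ (p' - 1)`, minus the radial derivative of the extremal function. -/
noncomputable def profile (K C : Set (E d)) (p : ℝ≥0∞) (h u : ℝ) : ℝ :=
  g K C h u ^ (conjR p - 1)

lemma extremal_eq (hK : IsNormBody K) {C : Set (E d)} {p : ℝ≥0∞} {h : ℝ} (hh : 0 < h) :
    extremal K C p h = fun y => radialPrimitive (profile K C p h) h (gauge K y) := by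
  ext y
  by_cases hy : gauge K y < h
  · rw [extremal, if_pos ((hK.mem_smul_iff hh).2 hy), radialPrimitive, min_eq_left hy.le]
    rfl
  · rw [extremal, if_neg fun h' => hy ((hK.mem_smul_iff hh).1 h'),
      radialPrimitive_of_le (not_lt.1 hy)]

section Profile

variable {p : ℝ≥0∞} {h : ℝ}

lemma g_eq (hd : 1 ≤ d) (hh : 0 < h) {u : ℝ} (hu : 0 < u) :
    g K C h u = 1 / (d * vol K C) * (1 / u ^ (d - 1)) * (1 - (u / h) ^ d) := by
  rw [g, div_pow, mul_assoc]
  congr 1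
  have : u ^ d = u ^ (d - 1) * u := by rw [← pow_succ, Nat.sub_add_cancel hd]
  rw [this]
  field_simp

lemma g_nonneg (hd : 1 ≤ d) (hh : 0 < h) {u : ℝ} (hu : u ∈ Icc 0 h) : 0 ≤ g K C h u := by
  have hv : 0 ≤ vol K (C : Set (E d)) := measureReal_nonneg
  rcases hu.1.eq_or_lt with h0 | h0
  · rw [g, ← h0, zero_div, sub_zero]
    positivity
  · rw [g_eq hd hh h0]
    have : (u / h) ^ d ≤ 1 := pow_le_one₀ (div_nonneg h0.le hh.le) ((div_le_one hh).2 hu.2)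
    have : 0 ≤ 1 - (u / h) ^ d := by linarith
    positivity

lemma g_pos (hd : 1 ≤ d) (hv : 0 < vol K (C : Set (E d))) (hh : 0 < h) {u : ℝ}
    (hu : u ∈ Ioo 0 h) : 0 < g K C h u := by
  have hu0 := hu.1
  have hd0 : (0 : ℝ) < d := by exact_mod_cast hd
  rw [g_eq hd hh hu0]
  have : (u / h) ^ d < 1 :=
    pow_lt_one₀ (div_nonneg hu0.le hh.le) ((div_lt_one hh).2 hu.2) (by omega)
  have : 0 < 1 - (u / h) ^ d := by linarith
  positivity

lemma profile_nonneg (hd : 1 ≤ d) (hh : 0 < h) {u : ℝ} (hu : u ∈ Icc 0 h) :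
    0 ≤ profile K C p h u := Real.rpow_nonneg (g_nonneg hd hh hu) _

lemma profile_pos (hd : 1 ≤ d) (hv : 0 < vol K (C : Set (E d))) (hh : 0 < h) {u : ℝ}
    (hu : u ∈ Ioo 0 h) : 0 < profile K C p h u := Real.rpow_pos_of_pos (g_pos hd hv hh hu) _

lemma measurable_profile (K C : Set (E d)) (p : ℝ≥0∞) (h : ℝ) : Measurable (profile K C p h) :=
  (measurable_g K C h).pow_const _

lemma continuousOn_profile (hp : 1 < p) : ContinuousOn (profile K C p h) (Ioc 0 h) := by
  refine ContinuousOn.rpow_const ?_ fun _ _ => Or.inr (sub_nonneg.2 (one_le_conjR hp))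
  unfold g
  refine continuousOn_const.mul (ContinuousOn.sub ?_ (by fun_prop))
  exact continuousOn_const.div (by fun_prop) fun u hu => pow_ne_zero _ hu.1.ne'

lemma integrableOn_profile (hd : 1 ≤ d) (hp : (d : ℝ≥0∞) < p) (hh : 0 < h) :
    IntegrableOn (profile K C p h) (Ioo 0 h) := by
  have hq : 0 ≤ conjR p - 1 := sub_nonneg.2 (one_le_conjR (one_lt_of_dim_lt hd hp))
  have hv : 0 ≤ vol K (C : Set (E d)) := measureReal_nonneg
  have h1 : IntegrableOn (fun u : ℝ => (1 / (d * vol K C)) ^ (conjR p - 1) *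
      u ^ (-(((d : ℝ) - 1) * (conjR p - 1)))) (Ioo 0 h) := by
    refine Integrable.const_mul ?_ _
    have h2 := intervalIntegral.intervalIntegrable_rpow' (a := 0) (b := h)
      (r := -(((d : ℝ) - 1) * (conjR p - 1))) (by linarith [dim_sub_one_mul_conjR_lt hd hp])
    exact (intervalIntegrable_iff_integrableOn_Ioo_of_le hh.le).1 h2
  refine h1.mono' (measurable_profile K C p h).aestronglyMeasurable ?_
  refine (ae_restrict_iff' measurableSet_Ioo).2 (ae_of_all _ fun u hu => ?_)
  have hu0 := hu.1
  have hu' : u ∈ Icc 0 h := ⟨hu.1.le, hu.2.le⟩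
  rw [Real.norm_of_nonneg (profile_nonneg hd hh hu'), profile]
  have hdc : ((d - 1 : ℕ) : ℝ) = (d : ℝ) - 1 := by rw [Nat.cast_sub hd, Nat.cast_one]
  have h3 : (1 / (d * vol K C)) ^ (conjR p - 1) * u ^ (-(((d : ℝ) - 1) * (conjR p - 1))) =
      (1 / (d * vol K C) * (1 / u ^ (d - 1))) ^ (conjR p - 1) := by
    rw [Real.mul_rpow (by positivity) (by positivity), ← neg_mul, Real.rpow_mul hu0.le,
      Real.rpow_neg hu0.le, ← hdc, Real.rpow_natCast, one_div (u ^ (d - 1))]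
  rw [h3]
  refine Real.rpow_le_rpow (g_nonneg hd hh hu') ?_ hq
  rw [g_eq hd hh hu0]
  refine mul_le_of_le_one_right (by positivity) ?_
  have : 0 ≤ (u / h) ^ d := by positivity
  linarith

lemma ofReal_radialPrimitive_profile (hd : 1 ≤ d) (hp : (d : ℝ≥0∞) < p) (hh : 0 < h) {r : ℝ}
    (hr : 0 ≤ r) (hrh : r ≤ h) :
    ENNReal.ofReal (radialPrimitive (profile K C p h) h r) =
      ∫⁻ u in Ioo r h, ENNReal.ofReal (profile K C p h u) := by
  rw [radialPrimitive, min_eq_left hrh, lintegral_Ioo_eq_ofReal_intervalIntegral hrh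
    ((integrableOn_profile hd hp hh).mono_set (Ioo_subset_Ioo_left hr))]
  exact fun u hu => profile_nonneg hd hh ⟨hr.trans hu.1.le, hu.2.le⟩

lemma radialPrimitive_profile_nonneg (hd : 1 ≤ d) (hh : 0 < h) {r : ℝ} (hr : 0 ≤ r) :
    0 ≤ radialPrimitive (profile K C p h) h r :=
  intervalIntegral.integral_nonneg (min_le_right _ _) fun _ hu =>
    profile_nonneg hd hh ⟨(le_min hr hh.le).trans hu.1, hu.2⟩

lemma extremal_nonneg (hd : 1 ≤ d) (hK : IsNormBody K) (hh : 0 < h) (y : E d) :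
    0 ≤ extremal K C p h y := by
  rw [extremal_eq hK hh]
  exact radialPrimitive_profile_nonneg hd hh (gauge_nonneg y)

lemma continuous_extremal (hd : 1 ≤ d) (hK : IsNormBody K) (hp : (d : ℝ≥0∞) < p) (hh : 0 < h) :
    Continuous (extremal K (C : Set (E d)) p h) := by
  rw [extremal_eq hK hh]
  exact (continuousOn_radialPrimitive hh (integrableOn_profile hd hp hh)).comp_continuous
    hK.continuous_gauge fun x => gauge_nonneg x

lemma isWeakGradient_extremal (hd : 1 ≤ d) (hK : IsNormBody K) (hp : (d : ℝ≥0∞) < p) (hh : 0 < h) :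
    IsWeakGradient (C : Set (E d)) (extremal K C p h)
      (radialGradient K (profile K C p h) h) := by
  rw [extremal_eq hK hh]
  exact isWeakGradient_radial hd hK hh (measurable_profile K C p h)
    (continuousOn_profile (one_lt_of_dim_lt hd hp)) (integrableOn_profile hd hp hh)

lemma dualNorm_weakGradient_extremal (hd : 1 ≤ d) (hK : IsNormBody K)
    (hCo : IsOpen (C : Set (E d))) (hp : (d : ℝ≥0∞) < p) (hh : 0 < h) :
    (fun x => dualNorm K (weakGradient (C : Set (E d)) (extremal K C p h) x))
      =ᵐ[volume.restrict (C : Set (E d))]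
      fun x => (Iio h).indicator (profile K C p h) (gauge K x) := by
  have hG := isWeakGradient_extremal (C := C) hd hK hp hh
  have h0 : ∀ᵐ v : E d, v ≠ 0 := by
    rw [ae_iff]
    simpa using volume_singleton_zero hd
  filter_upwards [(isWeakGradient_weakGradient ⟨_, hG⟩).ae_eq hCo hG, ae_restrict_of_ae h0,
    ae_restrict_of_ae (ae_differentiableAt_gauge hK)] with x hx hx0 hxd
  rw [hx, hK.dualNorm_of_fderiv_gauge hx0 hxd fun v => inner_radialGradient v x, abs_neg,
    abs_of_nonneg]
  refine indicator_apply_nonneg fun hx => ?_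
  exact profile_nonneg hd hh ⟨gauge_nonneg x, (show gauge K x < h from hx).le⟩

end Profile

/-! ### The norms of the extremal function -/

/-- `∫_{hK ∩ C} g_h(|x|_K) ^ p' dx`. -/
noncomputable def gEnergy (K C : Set (E d)) (p : ℝ≥0∞) (h : ℝ) : ℝ≥0∞ :=
  ∫⁻ x in (h • K) ∩ C, ENNReal.ofReal (g K C h (gauge K x)) ^ conjR p

/-- The supremum `∫_0^h g_h ^ (p' - 1)` of the extremal function, attained at the vertex. -/
noncomputable def profileMass (K C : Set (E d)) (p : ℝ≥0∞) (h : ℝ) : ℝ≥0∞ :=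
  ∫⁻ u in Ioo 0 h, ENNReal.ofReal (profile K C p h u)

lemma lintegral_smul_inter_congr (hK : IsNormBody K) (hCo : IsOpen (C : Set (E d))) (hh : 0 < h)
    (F : ℝ → ℝ≥0∞) :
    ∫⁻ x in (C : Set (E d)), (Iio h).indicator F (gauge K x) =
      ∫⁻ x in (h • K) ∩ (C : Set (E d)), F (gauge K x) := by
  rw [← lintegral_indicator hCo.measurableSet,
    ← lintegral_indicator (isOpen_smul_inter hK hCo hh).measurableSet]
  refine lintegral_congr fun x => ?_
  by_cases hx : x ∈ (C : Set (E d)) <;> by_cases hx' : gauge K x < h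
  · rw [indicator_of_mem hx, indicator_of_mem (show gauge K x ∈ Iio h from hx'),
      indicator_of_mem (show x ∈ h • K ∩ (C : Set (E d)) from ⟨(hK.mem_smul_iff hh).2 hx', hx⟩)]
  · rw [indicator_of_mem hx, indicator_of_notMem (show gauge K x ∉ Iio h from hx'),
      indicator_of_notMem (fun h' => hx' ((hK.mem_smul_iff hh).1 h'.1))]
  · rw [indicator_of_notMem hx, indicator_of_notMem fun h' => hx h'.2]
  · rw [indicator_of_notMem hx, indicator_of_notMem fun h' => hx h'.2]

lemma gNorm_eq (hd : 1 ≤ d) (hK : IsNormBody K) (hCo : IsOpen (C : Set (E d))) (hp : 1 < p)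
    (hh : 0 < h) : gNorm K C p h = gEnergy K C p h ^ (conjR p)⁻¹ := by
  have h0 : ENNReal.conjExponent p ≠ 0 := by
    rw [ENNReal.conjExponent]; exact (zero_lt_one.trans_le le_self_add).ne'
  rw [gNorm, eLpNorm_eq_lintegral_rpow_enorm_toReal h0 (conjExponent_ne_top hp), one_div]
  change (∫⁻ x in _, _ ^ conjR p) ^ (conjR p)⁻¹ = _
  congr 1
  refine setLIntegral_congr_fun (isOpen_smul_inter hK hCo hh).measurableSet fun x hx => ?_
  rw [Real.enorm_of_nonneg]
  exact g_nonneg hd hh ⟨gauge_nonneg x, ((hK.mem_smul_iff hh).1 hx.1).le⟩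

lemma gradNorm_extremal (hd : 1 ≤ d) (hK : IsNormBody K) (hCo : IsOpen (C : Set (E d)))
    (hCn : (C : Set (E d)).Nonempty) (hp : (d : ℝ≥0∞) < p) (hh : 0 < h) :
    gradNorm K C p (extremal K C p h) = gEnergy K C p h ^ p.toReal⁻¹ := by
  have hv := vol_pos hK hCo hCn
  have hp1 := one_lt_of_dim_lt hd hp
  have hSm := (isOpen_smul_inter hK hCo hh).measurableSet
  rw [gradNorm, eLpNorm_congr_ae (dualNorm_weakGradient_extremal hd hK hCo hp hh)]
  rcases eq_or_ne p ∞ with rfl | hpt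
  · rw [ENNReal.toReal_top, inv_zero, ENNReal.rpow_zero, eLpNorm_exponent_top]
    have hq : conjR ∞ - 1 = 0 := by
      rw [conjR_eq_inv hp1]; simp
    have hprof : profile K (C : Set (E d)) ∞ h = fun _ => 1 := by
      ext u; rw [profile, hq, Real.rpow_zero]
    rw [hprof]
    refine le_antisymm (eLpNormEssSup_le_of_ae_enorm_bound (ae_of_all _ fun x => ?_)) ?_
    · by_cases hx : gauge K x ∈ Iio h
      · rw [indicator_of_mem hx]; simp
      · rw [indicator_of_notMem hx]; simp
    · have hle : eLpNormEssSup (fun _ : E d => (1 : ℝ))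
          (volume.restrict ((h • K) ∩ (C : Set (E d)))) ≤
          eLpNormEssSup (fun x => (Iio h).indicator (fun _ => (1 : ℝ)) (gauge K x))
          (volume.restrict (C : Set (E d))) := by
        rw [← eLpNorm_exponent_top, ← eLpNorm_exponent_top]
        refine le_trans (le_of_eq (eLpNorm_congr_ae ?_))
          (eLpNorm_mono_measure _ (Measure.restrict_mono inter_subset_right le_rfl))
        refine (ae_restrict_iff' hSm).2 (ae_of_all _ fun x hx => ?_)
        exact (indicator_of_mem (show gauge K x ∈ Iio h from (hK.mem_smul_iff hh).1 hx.1)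
          (fun _ => (1 : ℝ))).symm
      refine le_trans (le_of_eq ?_) hle
      rw [eLpNormEssSup_const]
      · simp
      · rw [Ne, Measure.restrict_eq_zero, volume_smul_inter hK hh, ENNReal.ofReal_eq_zero, not_le]
        positivity
  · have hp0 : p ≠ 0 := (zero_lt_one.trans hp1).ne'
    have hpr : 0 < p.toReal := ENNReal.toReal_pos hp0 hpt
    rw [eLpNorm_eq_lintegral_rpow_enorm_toReal hp0 hpt, one_div]
    congr 1
    have e1 : ∀ x : E d, ‖(Iio h).indicator (profile K (C : Set (E d)) p h) (gauge K x)‖ₑ ^ p.toReal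
        = (Iio h).indicator (fun u => ENNReal.ofReal (g K C h u) ^ conjR p) (gauge K x) := by
      intro x
      by_cases hx : gauge K x ∈ Iio h
      · have hxI : gauge K x ∈ Icc 0 h := ⟨gauge_nonneg x, (show gauge K x < h from hx).le⟩
        rw [indicator_of_mem hx, indicator_of_mem hx,
          Real.enorm_of_nonneg (profile_nonneg hd hh hxI), profile,
          ← ENNReal.ofReal_rpow_of_nonneg (g_nonneg hd hh hxI)
            (sub_nonneg.2 (one_le_conjR hp1)), ← ENNReal.rpow_mul]
        congr 1
        have h1 := inv_add_inv_conjR hp1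
        have h2 := one_le_conjR hp1
        field_simp at h1
        linarith
      · rw [indicator_of_notMem hx, indicator_of_notMem hx, enorm_zero, ENNReal.zero_rpow_of_pos hpr]
    simp_rw [e1]
    exact lintegral_smul_inter_congr hK hCo hh (fun u => ENNReal.ofReal (g K C h u) ^ conjR p)

lemma ofReal_extremal (hd : 1 ≤ d) (hK : IsNormBody K) (hp : (d : ℝ≥0∞) < p) (hh : 0 < h) (y : E d) :
    ENNReal.ofReal (extremal K C p h y) = (Iio h).indicator
      (fun r => ∫⁻ u in Ioo r h, ENNReal.ofReal (profile K C p h u)) (gauge K y) := by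
  rw [extremal_eq hK hh]
  simp only
  by_cases hy : gauge K y < h
  · rw [indicator_of_mem (show gauge K y ∈ Iio h from hy),
      ofReal_radialPrimitive_profile hd hp hh (gauge_nonneg y) hy.le]
  · rw [indicator_of_notMem (show gauge K y ∉ Iio h from hy), radialPrimitive_of_le (not_lt.1 hy),
      ENNReal.ofReal_zero]

lemma oneNorm_extremal (hd : 1 ≤ d) (hK : IsNormBody K) (hCo : IsOpen (C : Set (E d)))
    (hp : (d : ℝ≥0∞) < p) (hh : 0 < h) :
    oneNorm C (extremal K C p h) = ∫⁻ x in (h • K) ∩ (C : Set (E d)),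
      ∫⁻ u in Ioo (gauge K x) h, ENNReal.ofReal (profile K C p h u) := by
  rw [oneNorm, eLpNorm_one_eq_lintegral_enorm, ← lintegral_smul_inter_congr hK hCo hh
    (fun r => ∫⁻ u in Ioo r h, ENNReal.ofReal (profile K C p h u))]
  refine lintegral_congr fun x => ?_
  rw [Real.enorm_of_nonneg (extremal_nonneg hd hK hh x), ofReal_extremal hd hK hp hh]

lemma profileMass_lt_top (hd : 1 ≤ d) (hp : (d : ℝ≥0∞) < p) (hh : 0 < h) :
    profileMass K (C : Set (E d)) p h < ∞ := by
  rw [profileMass, ← ofReal_radialPrimitive_profile hd hp hh le_rfl hh.le]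
  exact ENNReal.ofReal_lt_top

lemma supNorm_extremal (hd : 1 ≤ d) (hK : IsNormBody K) (hCo : IsOpen (C : Set (E d)))
    (hCn : (C : Set (E d)).Nonempty) (hp : (d : ℝ≥0∞) < p) (hh : 0 < h) :
    supNorm C (extremal K C p h) = profileMass K C p h := by
  have hcont := continuous_extremal (C := C) hd hK hp hh
  rw [supNorm, eLpNorm_exponent_top]
  refine le_antisymm (eLpNormEssSup_le_of_ae_enorm_bound (ae_of_all _ fun x => ?_)) ?_
  · rw [Real.enorm_of_nonneg (extremal_nonneg hd hK hh x), ofReal_extremal hd hK hp hh]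
    refine indicator_apply_le' (fun _ => ?_) (fun _ => zero_le)
    exact lintegral_mono_set (Ioo_subset_Ioo_left (gauge_nonneg x))
  · have h0 : ‖extremal K (C : Set (E d)) p h 0‖ₑ = profileMass K C p h := by
      rw [Real.enorm_of_nonneg (extremal_nonneg hd hK hh 0), ofReal_extremal hd hK hp hh,
        gauge_zero, indicator_of_mem (show (0 : ℝ) ∈ Iio h from hh), profileMass]
    rw [← h0]
    by_contra hlt
    rw [not_le] at hlt
    have hopen : IsOpen {x : E d | eLpNormEssSup (extremal K (C : Set (E d)) p h)
        (volume.restrict (C : Set (E d))) < ‖extremal K (C : Set (E d)) p h x‖ₑ} :=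
      isOpen_lt continuous_const hcont.enorm
    have hne := mem_closure_iff.1 (zero_mem_closure_cone hCn) _ hopen hlt
    have hpos := (hopen.inter hCo).measure_pos volume hne
    have hae := enorm_ae_le_eLpNormEssSup (extremal K (C : Set (E d)) p h)
      (volume.restrict (C : Set (E d)))
    rw [ae_iff, Measure.restrict_apply' hCo.measurableSet] at hae
    simp only [not_le] at hae
    exact hpos.ne' hae

/-- The equality case of the additive inequality: averaging `f(0) - f(x) = ∫_0^{|x|_K} g ^ (p'-1)`
over `hK ∩ C` gives `μ(hK ∩ C) ∫ g ^ p'`. -/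
lemma ofReal_mul_profileMass (hd : 1 ≤ d) (hK : IsNormBody K) (hCo : IsOpen (C : Set (E d)))
    (hCn : (C : Set (E d)).Nonempty) (hp : (d : ℝ≥0∞) < p) (hh : 0 < h) :
    ENNReal.ofReal (h ^ d * vol K C) * profileMass K C p h =
      oneNorm C (extremal K C p h) + ENNReal.ofReal (h ^ d * vol K C) * gEnergy K C p h := by
  have hv := vol_pos hK hCo hCn
  have hd0 : (0 : ℝ) < d := by exact_mod_cast hd
  have hSm := (isOpen_smul_inter hK hCo hh).measurableSet
  have hprofm : Measurable (profile K (C : Set (E d)) p h) := measurable_profile _ _ _ _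
  have hgm : Measurable (gauge K) := hK.continuous_gauge.measurable
  set S := (h • K) ∩ (C : Set (E d)) with hS
  have hmemS : ∀ {x : E d}, x ∈ S ↔ gauge K x < h ∧ x ∈ (C : Set (E d)) := by
    intro v; rw [hS, mem_inter_iff, hK.mem_smul_iff hh]
  have hvS : volume S = ENNReal.ofReal (h ^ d * vol K C) := volume_smul_inter hK hh
  -- the layer `{u ≤ |x|_K < h}`
  have hlayer : ∀ u ∈ Ioo 0 h, volume ({x | u ≤ gauge K x} ∩ S) =
      ENNReal.ofReal ((h ^ d - u ^ d) * vol K C) := by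
    intro u hu
    have hsub : (u • K) ∩ (C : Set (E d)) ⊆ S := fun x hx =>
      hmemS.2 ⟨((hK.mem_smul_iff hu.1).1 hx.1).trans hu.2, hx.2⟩
    have heq : {x | u ≤ gauge K x} ∩ S = S \ ((u • K) ∩ (C : Set (E d))) := by
      ext x
      have h1 : x ∈ (u • K) ∩ (C : Set (E d)) ↔ gauge K x < u ∧ x ∈ (C : Set (E d)) := by
        rw [mem_inter_iff, hK.mem_smul_iff hu.1]
      have h2 : x ∈ {x | u ≤ gauge K x} ↔ ¬ gauge K x < u :=
        (not_lt.symm : u ≤ gauge K x ↔ ¬ gauge K x < u)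
      rw [mem_inter_iff, Set.mem_sdiff, h1, h2, hmemS]
      tauto
    rw [heq, measure_sdiff hsub (isOpen_smul_inter hK hCo hu.1).nullMeasurableSet
      (by rw [volume_smul_inter hK hu.1]; exact ENNReal.ofReal_ne_top), hvS,
      volume_smul_inter hK hu.1, ← ENNReal.ofReal_sub _ (by have := hu.1; positivity), sub_mul]
  have hsplit : ∀ x ∈ S, profileMass K C p h =
      (∫⁻ u in Ioo (gauge K x) h, ENNReal.ofReal (profile K C p h u)) +
        ∫⁻ u in Ioo 0 h, {u | u ≤ gauge K x}.indicator
          (fun u => ENNReal.ofReal (profile K C p h u)) u := by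
    intro x hx
    have hm : MeasurableSet {u : ℝ | u ≤ gauge K x} := measurableSet_Iic
    rw [profileMass, ← lintegral_inter_add_sdiff _ (Ioo 0 h) hm, add_comm]
    congr 1
    · congr 2
      ext u
      constructor
      · rintro ⟨⟨_, h2⟩, h3⟩
        exact ⟨not_le.1 h3, h2⟩
      · rintro ⟨h1, h2⟩
        exact ⟨⟨(gauge_nonneg x).trans_lt h1, h2⟩, not_le.2 h1⟩
    · rw [lintegral_indicator hm, Measure.restrict_restrict hm, inter_comm]
  have hmeas1 : Measurable fun x : E d =>
      ∫⁻ u in Ioo (gauge K x) h, ENNReal.ofReal (profile K C p h u) := by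
    have hanti : Antitone fun r : ℝ => ∫⁻ u in Ioo r h, ENNReal.ofReal (profile K C p h u) :=
      fun r s hrs => lintegral_mono_set (Ioo_subset_Ioo_left hrs)
    exact hanti.measurable.comp hgm
  have hinner : ∫⁻ x in S, ∫⁻ u in Ioo 0 h, {u | u ≤ gauge K x}.indicator
      (fun u => ENNReal.ofReal (profile K C p h u)) u =
      ENNReal.ofReal (h ^ d * vol K C) * gEnergy K C p h := by
    rw [lintegral_lintegral_swap]
    swap
    · have hset : MeasurableSet {q : E d × ℝ | q.2 ≤ gauge K q.1} :=
        measurableSet_le (by fun_prop) (by fun_prop)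
      have : Measurable ({q : E d × ℝ | q.2 ≤ gauge K q.1}.indicator
          fun q => ENNReal.ofReal (profile K (C : Set (E d)) p h q.2)) :=
        Measurable.indicator (by fun_prop) hset
      exact this.aemeasurable
    rw [gEnergy, lintegral_radial hd hK hCo hh (F := fun u =>
      ENNReal.ofReal (g K C h u) ^ conjR p) (by have := measurable_g K (C : Set (E d)) h; fun_prop),
      ← mul_assoc, ← lintegral_const_mul' _ _ (ENNReal.mul_ne_top ENNReal.ofReal_ne_top
        ENNReal.ofReal_ne_top)]
    refine setLIntegral_congr_fun measurableSet_Ioo fun u hu => ?_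
    have hu0 := hu.1
    have hm : MeasurableSet {x : E d | u ≤ gauge K x} := measurableSet_le (by fun_prop) hgm
    have e1 : ∀ x : E d, {u | u ≤ gauge K x}.indicator
        (fun u => ENNReal.ofReal (profile K (C : Set (E d)) p h u)) u =
        {x : E d | u ≤ gauge K x}.indicator
          (fun _ => ENNReal.ofReal (profile K (C : Set (E d)) p h u)) x := fun x => rfl
    simp_rw [e1]
    rw [lintegral_indicator hm, setLIntegral_const, Measure.restrict_apply hm, hlayer u hu,
      ENNReal.ofReal_rpow_of_pos (g_pos hd hv hh hu),
      ← ENNReal.ofReal_mul (profile_nonneg (C := C) hd hh ⟨hu.1.le, hu.2.le⟩),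
      ← ENNReal.ofReal_mul (Real.rpow_nonneg (g_pos hd hv hh hu).le _),
      ← ENNReal.ofReal_mul (by positivity), ← ENNReal.ofReal_mul (by positivity)]
    congr 1
    have e2 : g K C h u ^ conjR p = profile K C p h u * g K C h u := by
      rw [profile, ← Real.rpow_add_one (g_pos hd hv hh hu).ne', sub_add_cancel]
    rw [e2]
    have e3 : u ^ d = u ^ (d - 1) * u := by rw [← pow_succ, Nat.sub_add_cancel hd]
    have e4 : d * vol K C * (g K C h u * u ^ (d - 1)) = 1 - u ^ d / h ^ d := by
      rw [g, e3]
      field_simp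
    calc profile K C p h u * ((h ^ d - u ^ d) * vol K C)
        = h ^ d * vol K C * profile K C p h u * (1 - u ^ d / h ^ d) := by
          field_simp
      _ = _ := by rw [← e4]; ring
  calc ENNReal.ofReal (h ^ d * vol K C) * profileMass K C p h
      = ∫⁻ x in S, profileMass K C p h := by rw [setLIntegral_const, hvS, mul_comm]
    _ = ∫⁻ x in S, ((∫⁻ u in Ioo (gauge K x) h, ENNReal.ofReal (profile K C p h u)) +
        ∫⁻ u in Ioo 0 h, {u | u ≤ gauge K x}.indicator
          (fun u => ENNReal.ofReal (profile K C p h u)) u) :=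
        setLIntegral_congr_fun hSm hsplit
    _ = _ := by
        rw [lintegral_add_left hmeas1, hinner, oneNorm_extremal hd hK hCo hp hh]

/-! ### Seminorms and the `L_1` norm -/

lemma seminormAt_le_oneNorm (K : Set (E d)) (hCo : IsOpen (C : Set (E d))) (h : ℝ)
    (f : E d → ℝ) : seminormAt K C h f ≤ oneNorm C f := by
  rw [oneNorm, eLpNorm_one_eq_lintegral_enorm]
  refine iSup₂_le fun x hx => (enorm_integral_le_lintegral_enorm _).trans ?_
  have h1 := lintegral_add_left_eq_self (μ := volume)
    ((C : Set (E d)).indicator fun y => ‖f y‖ₑ) x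
  rw [lintegral_indicator hCo.measurableSet] at h1
  rw [← h1]
  refine (lintegral_mono_set inter_subset_right).trans ?_
  refine le_trans (setLIntegral_mono' hCo.measurableSet fun u hu => ?_)
    (setLIntegral_le_lintegral (C : Set (E d)) _)
  rw [indicator_of_mem (add_mem_cone hx hu)]

/-- The extremal function is continuous up to the vertex, where its average is the integral over
its support. -/
lemma oneNorm_extremal_le_seminormAt (hd : 1 ≤ d) (hK : IsNormBody K)
    (hCo : IsOpen (C : Set (E d))) (hCn : (C : Set (E d)).Nonempty) (hp : (d : ℝ≥0∞) < p)
    (hh : 0 < h) :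
    oneNorm C (extremal K C p h) ≤ seminormAt K C h (extremal K C p h) := by
  have hcont := continuous_extremal (C := C) hd hK hp hh
  have hSm := (isOpen_smul_inter hK hCo hh).measurableSet
  have hbound : ∀ x, ‖extremal K (C : Set (E d)) p h x‖ ≤
      ∫ u in Ioo 0 h, |profile K (C : Set (E d)) p h u| := by
    intro x
    rw [extremal_eq hK hh, Real.norm_eq_abs]
    exact abs_radialPrimitive_le hh (integrableOn_profile hd hp hh) (gauge_nonneg x)
  have hfin : IsFiniteMeasure (volume.restrict ((h • K) ∩ (C : Set (E d)))) :=
    ⟨by rw [Measure.restrict_apply_univ]; exact (isBounded_smul_inter hK C h).measure_lt_top⟩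
  have hΨ : Continuous fun x => ∫ u in (h • K) ∩ (C : Set (E d)), extremal K C p h (x + u) :=
    continuous_of_dominated (fun x => (hcont.comp (by fun_prop)).aestronglyMeasurable)
      (fun x => ae_of_all _ fun u => hbound _) (integrable_const _)
      (ae_of_all _ fun u => hcont.comp (by fun_prop))
  have hclosed : IsClosed {x : E d | ‖∫ u in (h • K) ∩ (C : Set (E d)),
      extremal K C p h (x + u)‖ₑ ≤ seminormAt K C h (extremal K C p h)} :=
    isClosed_le hΨ.enorm continuous_const
  have hsub : ∀ x ∈ (C : Set (E d)), ‖∫ u in (h • K) ∩ (C : Set (E d)),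
      extremal K C p h (x + u)‖ₑ ≤ seminormAt K C h (extremal K C p h) :=
    fun x hx => le_iSup₂_of_le x hx le_rfl
  have h0 : ‖∫ u in (h • K) ∩ (C : Set (E d)), extremal K C p h (0 + u)‖ₑ ≤
      seminormAt K C h (extremal K C p h) :=
    hclosed.closure_subset_iff.2 hsub (zero_mem_closure_cone hCn)
  refine le_trans (le_of_eq ?_) h0
  simp only [zero_add]
  rw [Real.enorm_of_nonneg (integral_nonneg fun x => extremal_nonneg hd hK hh x),
    ofReal_integral_eq_lintegral_ofReal ((integrable_const _).mono' hcont.aestronglyMeasurable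
      (ae_of_all _ hbound)) (ae_of_all _ fun x => extremal_nonneg hd hK hh x),
    oneNorm_extremal hd hK hCo hp hh]
  refine setLIntegral_congr_fun hSm fun x hx => ?_
  rw [ofReal_extremal hd hK hp hh,
    indicator_of_mem (show gauge K x ∈ Iio h from (hK.mem_smul_iff hh).1 hx.1)]

lemma seminormAt_extremal (hd : 1 ≤ d) (hK : IsNormBody K)
    (hCo : IsOpen (C : Set (E d))) (hCn : (C : Set (E d)).Nonempty) (hp : (d : ℝ≥0∞) < p)
    (hh : 0 < h) :
    seminormAt K C h (extremal K C p h) = oneNorm C (extremal K C p h) :=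
  le_antisymm (seminormAt_le_oneNorm K hCo h _)
    (oneNorm_extremal_le_seminormAt hd hK hCo hCn hp hh)

lemma seminormSup_le_oneNorm (K : Set (E d)) (hCo : IsOpen (C : Set (E d))) (f : E d → ℝ) :
    seminormSup K C f ≤ oneNorm C f :=
  iSup₂_le fun h _ => seminormAt_le_oneNorm K hCo h f

lemma seminormAt_le_seminormSup (K C : Set (E d)) (hh : 0 < h) (f : E d → ℝ) :
    seminormAt K C h f ≤ seminormSup K C f :=
  le_iSup₂_of_le h hh le_rfl

lemma seminormSup_extremal (hd : 1 ≤ d) (hK : IsNormBody K)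
    (hCo : IsOpen (C : Set (E d))) (hCn : (C : Set (E d)).Nonempty) (hp : (d : ℝ≥0∞) < p)
    (hh : 0 < h) :
    seminormSup K C (extremal K C p h) = oneNorm C (extremal K C p h) :=
  le_antisymm (seminormSup_le_oneNorm K hCo _)
    ((oneNorm_extremal_le_seminormAt hd hK hCo hCn hp hh).trans
      (seminormAt_le_seminormSup K C hh _))

/-! ### The norm of the kernel in terms of the Beta function -/

lemma lintegral_rpow_mul_one_sub_rpow {a b : ℝ} (ha : 0 < a) (hb : 0 < b) :
    ∫⁻ t in Ioo (0 : ℝ) 1, ENNReal.ofReal (t ^ (a - 1) * (1 - t) ^ (b - 1)) =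
      ENNReal.ofReal (ProbabilityTheory.beta a b) := by
  have hB := ProbabilityTheory.beta_pos ha hb
  have h1 := ProbabilityTheory.lintegral_betaPDF (α := a) (β := b)
  rw [ProbabilityTheory.lintegral_betaPDF_eq_one ha hb] at h1
  have h2 : ∀ t : ℝ, ENNReal.ofReal (1 / ProbabilityTheory.beta a b * t ^ (a - 1) *
      (1 - t) ^ (b - 1)) = ENNReal.ofReal (1 / ProbabilityTheory.beta a b) *
      ENNReal.ofReal (t ^ (a - 1) * (1 - t) ^ (b - 1)) := fun t => by
    rw [← ENNReal.ofReal_mul (by positivity), mul_assoc]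
  simp_rw [h2] at h1
  rw [lintegral_const_mul' _ _ ENNReal.ofReal_ne_top] at h1
  have h3 : ENNReal.ofReal (ProbabilityTheory.beta a b) *
      ENNReal.ofReal (1 / ProbabilityTheory.beta a b) = 1 := by
    rw [← ENNReal.ofReal_mul hB.le, mul_one_div_cancel hB.ne', ENNReal.ofReal_one]
  rw [← one_mul (∫⁻ t in Ioo (0 : ℝ) 1, _), ← h3, mul_assoc, ← h1, mul_one]

lemma beta_arg_pos (hd : 1 ≤ d) (hp : (d : ℝ≥0∞) < p) : 0 < 1 - ((d : ℝ) - 1) * conjR p / d := by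
  have hd0 : (0 : ℝ) < d := by exact_mod_cast hd
  have := dim_sub_one_mul_conjR_lt hd hp
  rw [sub_pos, div_lt_one hd0]
  linarith

/-- The substitution `t = (u / h) ^ d` turns the energy of the kernel into a Beta integral. -/
lemma gEnergy_eq (hd : 1 ≤ d) (hK : IsNormBody K) (hCo : IsOpen (C : Set (E d)))
    (hCn : (C : Set (E d)).Nonempty) (hp : (d : ℝ≥0∞) < p) (hh : 0 < h) :
    gEnergy K C p h = ENNReal.ofReal (vol K C * h ^ d * ((1 / (d * vol K C)) ^ conjR p *
      h ^ (-(((d : ℝ) - 1) * conjR p))) *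
        ProbabilityTheory.beta (1 - ((d : ℝ) - 1) * conjR p / d) (conjR p + 1)) := by
  have hv := vol_pos hK hCo hCn
  have hd0 : (0 : ℝ) < d := by exact_mod_cast hd
  have hdc : ((d - 1 : ℕ) : ℝ) = (d : ℝ) - 1 := by rw [Nat.cast_sub hd, Nat.cast_one]
  have hc1 := one_le_conjR (one_lt_of_dim_lt hd hp)
  have hβ := lintegral_rpow_mul_one_sub_rpow (beta_arg_pos hd hp)
    (show 0 < conjR p + 1 by linarith)
  set c := conjR p with hc
  set a := 1 - ((d : ℝ) - 1) * c / d with ha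
  set B := ProbabilityTheory.beta a (c + 1) with hB
  set κ : ℝ := (1 / (d * vol K C)) ^ c * h ^ (-(((d : ℝ) - 1) * c)) with hκ
  have himage : (fun u : ℝ => (u / h) ^ d) '' Ioo 0 h = Ioo 0 1 := by
    ext t
    constructor
    · rintro ⟨u, hu, rfl⟩
      have h0 : 0 < u / h := div_pos hu.1 hh
      exact ⟨pow_pos h0 d, pow_lt_one₀ h0.le ((div_lt_one hh).2 hu.2) (by omega)⟩
    · rintro ⟨ht0, ht1⟩
      refine ⟨h * t ^ (d : ℝ)⁻¹, ⟨by positivity, ?_⟩, ?_⟩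
      · exact mul_lt_of_lt_one_right hh (Real.rpow_lt_one ht0.le ht1 (by positivity))
      · simp only
        rw [mul_div_cancel_left₀ _ hh.ne', Real.rpow_inv_natCast_pow ht0.le (by omega)]
  have hinj : InjOn (fun u : ℝ => (u / h) ^ d) (Ioo 0 h) := by
    intro u hu w hw huw
    have := (pow_left_inj₀ (div_pos hu.1 hh).le (div_pos hw.1 hh).le (by omega)).1 huw
    field_simp at this
    exact this
  have hder : ∀ u ∈ Ioo 0 h, HasDerivWithinAt (fun u : ℝ => (u / h) ^ d)
      (d * (u / h) ^ (d - 1) * (1 / h)) (Ioo 0 h) u := fun u _ =>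
    (((hasDerivAt_id u).div_const h).pow d).hasDerivWithinAt
  rw [← himage, lintegral_image_eq_lintegral_abs_deriv_mul measurableSet_Ioo hder hinj] at hβ
  rw [gEnergy, lintegral_radial hd hK hCo hh (F := fun u => ENNReal.ofReal (g K C h u) ^ c)
    (by have := measurable_g K (C : Set (E d)) h; fun_prop)]
  have hcongr : ∫⁻ u in Ioo 0 h, ENNReal.ofReal (g K C h u) ^ c * ENNReal.ofReal (u ^ (d - 1)) =
      ∫⁻ u in Ioo 0 h, ENNReal.ofReal (κ * (h ^ d / d)) *
        (ENNReal.ofReal |d * (u / h) ^ (d - 1) * (1 / h)| *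
        ENNReal.ofReal (((u / h) ^ d) ^ (a - 1) * (1 - (u / h) ^ d) ^ (c + 1 - 1))) := by
    refine setLIntegral_congr_fun measurableSet_Ioo fun u hu => ?_
    have hu0 := hu.1
    have hr : 0 < u / h := div_pos hu0 hh
    have hr1 : 0 < 1 - (u / h) ^ d :=
      sub_pos.2 (pow_lt_one₀ hr.le ((div_lt_one hh).2 hu.2) (by omega))
    have hκ0 : 0 < κ := by positivity
    rw [ENNReal.ofReal_rpow_of_pos (g_pos hd hv hh hu),
      ← ENNReal.ofReal_mul (Real.rpow_nonneg (g_pos hd hv hh hu).le _),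
      ← ENNReal.ofReal_mul (abs_nonneg _), ← ENNReal.ofReal_mul (by positivity),
      abs_of_pos (by positivity)]
    congr 1
    have e1 : ((u / h) ^ d) ^ (a - 1) = (u / h) ^ (-(((d : ℝ) - 1) * c)) := by
      rw [← Real.rpow_natCast (u / h) d, ← Real.rpow_mul hr.le]
      congr 1
      rw [ha]
      field_simp
      ring
    have e2 : (1 / u ^ (d - 1)) ^ c = u ^ (-(((d : ℝ) - 1) * c)) := by
      rw [one_div, ← Real.rpow_natCast u (d - 1), hdc, ← Real.rpow_neg hu0.le,
        ← Real.rpow_mul hu0.le, neg_mul]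
    have e3 : h ^ d = h ^ (d - 1) * h := by rw [← pow_succ, Nat.sub_add_cancel hd]
    rw [g_eq hd hh hu0, Real.mul_rpow (by positivity) hr1.le,
      Real.mul_rpow (by positivity) (by positivity), e1, e2, add_sub_cancel_right,
      Real.div_rpow hu0.le hh.le, hκ, div_pow u h (d - 1), e3]
    have : 0 < h ^ (-(((d : ℝ) - 1) * c)) := by positivity
    field_simp
  rw [hcongr, lintegral_const_mul' _ _ ENNReal.ofReal_ne_top, hβ,
    ← ENNReal.ofReal_mul (by positivity), ← ENNReal.ofReal_mul (by positivity)]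
  congr 1
  field_simp

lemma constA_pos (hd : 1 ≤ d) (hp : (d : ℝ≥0∞) < p) : 0 < constA d p := by
  have hd0 : (0 : ℝ) < d := by exact_mod_cast hd
  have hc1 := one_le_conjR (one_lt_of_dim_lt hd hp)
  have := ProbabilityTheory.beta_pos (beta_arg_pos hd hp) (show 0 < conjR p + 1 by linarith)
  unfold constA
  positivity

lemma gNorm_eq_ofReal (hd : 1 ≤ d) (hK : IsNormBody K) (hCo : IsOpen (C : Set (E d)))
    (hCn : (C : Set (E d)).Nonempty) (hp : (d : ℝ≥0∞) < p) (hh : 0 < h) :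
    gNorm K C p h = ENNReal.ofReal
      (constA d p * vol K C ^ (-p.toReal⁻¹) * h ^ (1 - d * p.toReal⁻¹)) := by
  have hv := vol_pos hK hCo hCn
  have hd0 : (0 : ℝ) < d := by exact_mod_cast hd
  have hp1 := one_lt_of_dim_lt hd hp
  have hc1 := one_le_conjR hp1
  have hB := ProbabilityTheory.beta_pos (beta_arg_pos hd hp) (show 0 < conjR p + 1 by linarith)
  have hconj := inv_add_inv_conjR hp1
  rw [gNorm_eq hd hK hCo hp1 hh, gEnergy_eq hd hK hCo hCn hp hh,
    ENNReal.ofReal_rpow_of_pos (by positivity), constA]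
  congr 1
  set B := ProbabilityTheory.beta (1 - ((d : ℝ) - 1) * conjR p / d) (conjR p + 1)
  set c := conjR p
  have hc0 : 0 < c := by linarith
  rw [Real.mul_rpow (by positivity) hB.le, Real.mul_rpow (by positivity) (by positivity),
    Real.mul_rpow (by positivity) (by positivity), Real.mul_rpow (by positivity) (by positivity),
    ← Real.rpow_mul (by positivity), ← Real.rpow_mul hh.le, mul_inv_cancel₀ hc0.ne', Real.rpow_one,
    ← Real.rpow_natCast h d, ← Real.rpow_mul hh.le]
  have e1 : h ^ ((d : ℝ) * c⁻¹) * h ^ (-(((d : ℝ) - 1) * c) * c⁻¹) = h ^ (1 - d * p.toReal⁻¹) := by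
    rw [← Real.rpow_add hh]
    congr 1
    rw [neg_mul, mul_assoc, mul_inv_cancel₀ hc0.ne']
    linear_combination (d : ℝ) * hconj
  have e2 : vol K C ^ c⁻¹ * (1 / (d * vol K C)) = (d : ℝ)⁻¹ * vol K C ^ (-p.toReal⁻¹) := by
    have : -p.toReal⁻¹ = c⁻¹ - 1 := by linarith
    rw [this, Real.rpow_sub_one hv.ne']
    field_simp
  rw [← e1, one_div c]
  linear_combination (h ^ ((d : ℝ) * c⁻¹) * h ^ (-(((d : ℝ) - 1) * c) * c⁻¹) * B ^ c⁻¹) * e2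

/-! ### Optimising the additive inequality over the scale -/

/-- The minimum over `τ > 0` of `P τ ^ β + Q τ⁻¹` and its attainment. -/
lemma exists_minimizer_rpow_add_inv {β P Q : ℝ} (hβ : 0 < β) (hP : 0 < P) (hQ : 0 < Q) :
    (∃ τ > 0, P * τ ^ β + Q * τ⁻¹ =
      (β * P) ^ (1 / (1 + β)) * (1 / β + 1) * Q ^ (1 - 1 / (1 + β))) ∧
    ∀ σ > 0, (β * P) ^ (1 / (1 + β)) * (1 / β + 1) * Q ^ (1 - 1 / (1 + β)) ≤
      P * σ ^ β + Q * σ⁻¹ := by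
  set α := 1 / (1 + β) with hα
  set τ := (Q / (β * P)) ^ α with hτ
  have hτ0 : 0 < τ := by positivity
  have hτP : P * τ ^ β = Q * τ⁻¹ / β := by
    have h1 : τ ^ (β + 1) = Q / (β * P) := by
      rw [hτ, ← Real.rpow_mul (by positivity), hα, add_comm β 1,
        one_div_mul_cancel (by positivity), Real.rpow_one]
    rw [Real.rpow_add_one hτ0.ne'] at h1
    field_simp at h1 ⊢
    linarith
  have hmin : (β * P) ^ α * (1 / β + 1) * Q ^ (1 - α) = Q * τ⁻¹ * (1 / β + 1) := by
    have h1 : Q * τ⁻¹ = (β * P) ^ α * Q ^ (1 - α) := by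
      rw [hτ, Real.div_rpow hQ.le (by positivity), Real.rpow_sub hQ, Real.rpow_one]
      have : 0 < Q ^ α := by positivity
      have : 0 < (β * P) ^ α := by positivity
      field_simp
    rw [h1]
    ring
  rw [hmin]
  refine ⟨⟨τ, hτ0, by rw [hτP]; field_simp⟩, fun σ hσ => ?_⟩
  -- weighted arithmetic-geometric mean inequality for `ρ ^ β` and `ρ⁻¹`, `ρ = σ / τ`
  set ρ := σ / τ with hρ
  have hρ0 : 0 < ρ := by positivity
  have hσ' : σ = τ * ρ := by rw [hρ]; field_simp
  have hα0 : 0 < α := by positivity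
  have hα1 : 1 - α = β * α := by rw [hα]; field_simp; ring
  have hgm := Real.geom_mean_le_arith_mean2_weighted hα0.le (by rw [hα1]; positivity)
    (Real.rpow_nonneg hρ0.le β) (inv_nonneg.2 hρ0.le) (add_sub_cancel α 1)
  have h1 : (ρ ^ β) ^ α * ρ⁻¹ ^ (1 - α) = 1 := by
    rw [hα1, ← Real.rpow_mul hρ0.le, Real.inv_rpow hρ0.le, mul_inv_cancel₀]
    positivity
  rw [h1, hα1] at hgm
  have h2 : P * σ ^ β + Q * σ⁻¹ = Q * τ⁻¹ * (ρ ^ β / β + ρ⁻¹) := by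
    rw [hσ', Real.mul_rpow hτ0.le hρ0.le, ← mul_assoc, hτP, mul_inv]
    ring
  rw [h2]
  refine mul_le_mul_of_nonneg_left ?_ (by positivity)
  have h4 : (1 / β + 1) * (α * ρ ^ β + β * α * ρ⁻¹) = ρ ^ β / β + ρ⁻¹ := by
    rw [hα]; field_simp
  rw [← h4]
  exact le_mul_of_one_le_right (by positivity) hgm

section Constants

/-- The exponent `β = 1/d - 1/p` of `τ = h ^ d` in the norm of the kernel; `α = 1 / (1 + β)`. -/
lemma beta_exponent_pos (hd : 1 ≤ d) (hp : (d : ℝ≥0∞) < p) : 0 < (d : ℝ)⁻¹ - p.toReal⁻¹ :=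
  sub_pos.2 (inv_toReal_lt hd hp)

lemma alpha_eq (hd : 1 ≤ d) (hp : (d : ℝ≥0∞) < p) :
    alpha d p = 1 / (1 + ((d : ℝ)⁻¹ - p.toReal⁻¹)) := by
  have hd0 : (0 : ℝ) < d := by exact_mod_cast hd
  rw [alpha]
  split_ifs with h
  · subst h
    simp only [ENNReal.toReal_top, inv_zero, sub_zero]
    field_simp
  · have hpr : 0 < p.toReal := ENNReal.toReal_pos (pos_of_gt hp).ne' h
    have := beta_exponent_pos hd hp
    have h1 : p.toReal + (p.toReal - 1) * d =
        p.toReal * d * (1 + ((d : ℝ)⁻¹ - p.toReal⁻¹)) := by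
      field_simp
      ring
    rw [h1]
    field_simp

lemma constSmallA_eq (hd : 1 ≤ d) (hp : (d : ℝ≥0∞) < p) :
    constSmallA d p = (((d : ℝ)⁻¹ - p.toReal⁻¹) * constA d p) ^ alpha d p *
      (1 / ((d : ℝ)⁻¹ - p.toReal⁻¹) + 1) := by
  have hd0 : (0 : ℝ) < d := by exact_mod_cast hd
  rw [constSmallA]
  split_ifs with h
  · subst h
    simp only [ENNReal.toReal_top, inv_zero, sub_zero, one_div, inv_inv]
    rw [div_eq_inv_mul]
  · have hpr : 0 < p.toReal := ENNReal.toReal_pos (pos_of_gt hp).ne' h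
    have h1 : (d : ℝ)⁻¹ - p.toReal⁻¹ = (p.toReal - d) / (p.toReal * d) := by field_simp
    rw [h1, one_div_div]
    congr 2
    ring

lemma alpha_pos (hd : 1 ≤ d) (hp : (d : ℝ≥0∞) < p) : 0 < alpha d p := by
  have := beta_exponent_pos hd hp
  rw [alpha_eq hd hp]
  positivity

lemma alpha_lt_one (hd : 1 ≤ d) (hp : (d : ℝ≥0∞) < p) : alpha d p < 1 := by
  have := beta_exponent_pos hd hp
  rw [alpha_eq hd hp, div_lt_one (by positivity)]
  linarith

lemma constSmallA_pos (hd : 1 ≤ d) (hp : (d : ℝ≥0∞) < p) : 0 < constSmallA d p := by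
  have := beta_exponent_pos hd hp
  have := constA_pos hd hp
  rw [constSmallA_eq hd hp]
  positivity

end Constants

/-- The right side of the additive inequality as a function of the scale, with `τ = h ^ d`. -/
lemma additive_bound_eq (hd : 1 ≤ d) (hK : IsNormBody K) (hCo : IsOpen (C : Set (E d)))
    (hCn : (C : Set (E d)).Nonempty) (hp : (d : ℝ≥0∞) < p) (hh : 0 < h) {y z : ℝ} (hy : 0 ≤ y)
    (hz : 0 ≤ z) :
    gNorm K C p h * ENNReal.ofReal y + avgConst K C h * ENNReal.ofReal z =
      ENNReal.ofReal (constA d p * vol K C ^ (-p.toReal⁻¹) * y *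
        (h ^ d) ^ ((d : ℝ)⁻¹ - p.toReal⁻¹) + (vol K C)⁻¹ * z * (h ^ d)⁻¹) := by
  have hv := vol_pos hK hCo hCn
  have hA := constA_pos hd hp
  have hd0 : (0 : ℝ) < d := by exact_mod_cast hd
  rw [gNorm_eq_ofReal hd hK hCo hCn hp hh, avgConst, ← ENNReal.ofReal_mul (by positivity),
    ← ENNReal.ofReal_mul (by positivity), ← ENNReal.ofReal_add (by positivity) (by positivity)]
  congr 1
  have h1 : (h ^ d) ^ ((d : ℝ)⁻¹ - p.toReal⁻¹) = h ^ (1 - d * p.toReal⁻¹) := by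
    rw [← Real.rpow_natCast h d, ← Real.rpow_mul hh.le, mul_sub, mul_inv_cancel₀ hd0.ne']
  rw [h1]
  ring

lemma multiplicative_bound_eq (hd : 1 ≤ d) (hK : IsNormBody K) (hCo : IsOpen (C : Set (E d)))
    (hCn : (C : Set (E d)).Nonempty) (hp : (d : ℝ≥0∞) < p) {y z : ℝ} (hy : 0 < y) (hz : 0 < z) :
    multConst K C p * ENNReal.ofReal z ^ (1 - alpha d p) * ENNReal.ofReal y ^ alpha d p =
      ENNReal.ofReal ((((d : ℝ)⁻¹ - p.toReal⁻¹) *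
        (constA d p * vol K C ^ (-p.toReal⁻¹) * y)) ^ (1 / (1 + ((d : ℝ)⁻¹ - p.toReal⁻¹))) *
        (1 / ((d : ℝ)⁻¹ - p.toReal⁻¹) + 1) *
        ((vol K C)⁻¹ * z) ^ (1 - 1 / (1 + ((d : ℝ)⁻¹ - p.toReal⁻¹)))) := by
  have hv := vol_pos hK hCo hCn
  have hA := constA_pos hd hp
  have hd0 : (0 : ℝ) < d := by exact_mod_cast hd
  have hβ := beta_exponent_pos hd hp
  have hSA := constSmallA_pos hd hp
  rw [← alpha_eq hd hp, multConst, ENNReal.ofReal_rpow_of_pos hz, ENNReal.ofReal_rpow_of_pos hy,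
    ← ENNReal.ofReal_mul (by positivity), ← ENNReal.ofReal_mul (by positivity),
    constSmallA_eq hd hp]
  congr 1
  have hα := alpha_eq hd hp
  set β := (d : ℝ)⁻¹ - p.toReal⁻¹ with hβdef
  set α := alpha d p
  have h1 : (vol K C) ^ (-α / d) = (vol K C ^ (-p.toReal⁻¹)) ^ α * (vol K C)⁻¹ ^ (1 - α) := by
    rw [← Real.rpow_mul hv.le, ← Real.rpow_neg_one (vol K C), ← Real.rpow_mul hv.le,
      ← Real.rpow_add hv]
    congr 1
    have h2 : α * (1 + β) = 1 := by rw [hα]; field_simp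
    rw [hβdef] at h2
    rw [div_eq_mul_inv]
    linear_combination -h2
  have h2 : (β * (constA d p * vol K C ^ (-p.toReal⁻¹) * y)) ^ α =
      (β * constA d p) ^ α * (vol K C ^ (-p.toReal⁻¹)) ^ α * y ^ α := by
    rw [← Real.mul_rpow (by positivity) (by positivity), ← Real.mul_rpow (by positivity) hy.le]
    congr 1
    ring
  rw [h1, h2, Real.mul_rpow (by positivity) hz.le]
  ring

/-- The right side of the multiplicative inequality is the minimum over the scales of the right
side of the additive one. -/
lemma multiplicative_bound_le (hd : 1 ≤ d) (hK : IsNormBody K) (hCo : IsOpen (C : Set (E d)))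
    (hCn : (C : Set (E d)).Nonempty) (hp : (d : ℝ≥0∞) < p) {y z : ℝ} (hy : 0 < y) (hz : 0 < z)
    (hh : 0 < h) :
    multConst K C p * ENNReal.ofReal z ^ (1 - alpha d p) * ENNReal.ofReal y ^ alpha d p ≤
      gNorm K C p h * ENNReal.ofReal y + avgConst K C h * ENNReal.ofReal z := by
  have hv := vol_pos hK hCo hCn
  have hA := constA_pos hd hp
  rw [multiplicative_bound_eq hd hK hCo hCn hp hy hz,
    additive_bound_eq hd hK hCo hCn hp hh hy.le hz.le]
  exact ENNReal.ofReal_le_ofReal ((exists_minimizer_rpow_add_inv (beta_exponent_pos hd hp)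
    (by positivity) (by positivity)).2 _ (by positivity))

lemma exists_additive_bound_eq (hd : 1 ≤ d) (hK : IsNormBody K) (hCo : IsOpen (C : Set (E d)))
    (hCn : (C : Set (E d)).Nonempty) (hp : (d : ℝ≥0∞) < p) {y z : ℝ} (hy : 0 < y) (hz : 0 < z) :
    ∃ h > 0, gNorm K C p h * ENNReal.ofReal y + avgConst K C h * ENNReal.ofReal z =
      multConst K C p * ENNReal.ofReal z ^ (1 - alpha d p) * ENNReal.ofReal y ^ alpha d p := by
  have hv := vol_pos hK hCo hCn
  have hA := constA_pos hd hp
  have hd0 : (0 : ℝ) < d := by exact_mod_cast hd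
  obtain ⟨τ, hτ, h1⟩ := (exists_minimizer_rpow_add_inv (beta_exponent_pos hd hp)
    (show 0 < constA d p * vol K C ^ (-p.toReal⁻¹) * y by positivity)
    (show 0 < (vol K C)⁻¹ * z by positivity)).1
  refine ⟨τ ^ (d : ℝ)⁻¹, by positivity, ?_⟩
  rw [multiplicative_bound_eq hd hK hCo hCn hp hy hz,
    additive_bound_eq hd hK hCo hCn hp (by positivity) hy.le hz.le,
    Real.rpow_inv_natCast_pow hτ.le (by omega), h1]

/-- A quantity bounded by the additive expression at all scales is bounded by the multiplicative
one; the degenerate values `Y = 0` and `Z = 0` are reached by continuity. -/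
lemma le_multiplicative_bound (hd : 1 ≤ d) (hK : IsNormBody K) (hCo : IsOpen (C : Set (E d)))
    (hCn : (C : Set (E d)).Nonempty) (hp : (d : ℝ≥0∞) < p) {X Y Z : ℝ≥0∞} (hY : Y ≠ ∞) (hZ : Z ≠ ∞)
    (hX : ∀ h > 0, X ≤ gNorm K C p h * Y + avgConst K C h * Z) :
    X ≤ multConst K C p * Z ^ (1 - alpha d p) * Y ^ alpha d p := by
  have hα0 := alpha_pos hd hp
  have hα1 : 0 < 1 - alpha d p := sub_pos.2 (alpha_lt_one hd hp)
  have hlim : ∀ {W : ℝ≥0∞} {e : ℝ}, W ≠ ∞ → 0 < e → Tendsto (fun ε : ℝ =>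
      ENNReal.ofReal (W.toReal + ε) ^ e) (𝓝[>] 0) (𝓝 (W ^ e)) := by
    intro W e hW he
    have h1 : Continuous fun ε : ℝ => ENNReal.ofReal (W.toReal + ε) ^ e :=
      (ENNReal.continuous_rpow_const (y := e)).comp
        (ENNReal.continuous_ofReal.comp (by fun_prop))
    have h2 := (h1.tendsto 0).mono_left (nhdsWithin_le_nhds (s := Ioi 0))
    simpa [ENNReal.ofReal_toReal hW] using h2
  have hZe : Z ^ (1 - alpha d p) ≠ ∞ := ENNReal.rpow_ne_top_of_nonneg hα1.le hZ
  have hYe : Y ^ alpha d p ≠ ∞ := ENNReal.rpow_ne_top_of_nonneg hα0.le hY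
  have hc : multConst K C p ≠ ∞ := ENNReal.ofReal_ne_top
  have hT := ENNReal.Tendsto.mul (ENNReal.Tendsto.const_mul (hlim hZ hα1) (Or.inr hc))
    (Or.inr hYe) (hlim hY hα0) (Or.inr (ENNReal.mul_ne_top hc hZe))
  refine ge_of_tendsto hT ?_
  filter_upwards [self_mem_nhdsWithin] with ε (hε : 0 < ε)
  obtain ⟨h, hh, h1⟩ := exists_additive_bound_eq (K := K) (C := C) hd hK hCo hCn hp
    (show 0 < Y.toReal + ε by positivity) (show 0 < Z.toReal + ε by positivity)
  rw [← h1]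
  refine (hX h hh).trans ?_
  gcongr
  · rw [← ENNReal.ofReal_toReal hY]
    exact ENNReal.ofReal_le_ofReal (by rw [ENNReal.toReal_ofReal ENNReal.toReal_nonneg]; linarith)
  · rw [← ENNReal.ofReal_toReal hZ]
    exact ENNReal.ofReal_le_ofReal (by rw [ENNReal.toReal_ofReal ENNReal.toReal_nonneg]; linarith)

/-! ### Sharpness -/

section Sharpness

variable {V : Type*} {𝓕 : Set V} {X Y Z : V → ℝ≥0∞}

/-- A function with nonzero finite `Y`, `Z` that gives equality shows that the constants of an
additive inequality cannot be decreased. -/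
lemma sharpAdditive_of_eq {a b : ℝ≥0∞} (hle : ∀ f ∈ 𝓕, X f ≤ a * Y f + b * Z f) {f : V}
    (hf : f ∈ 𝓕) (heq : X f = a * Y f + b * Z f) (ha : a ≠ ∞) (hb : b ≠ ∞) (hY0 : Y f ≠ 0)
    (hY : Y f ≠ ∞) (hZ0 : Z f ≠ 0) (hZ : Z f ≠ ∞) : SharpAdditive 𝓕 X Y Z a b := by
  refine ⟨hle, fun a' ha' b' hb' h => ?_⟩
  have h1 := h f hf
  rw [heq] at h1
  have h2 : a' * Y f ≤ a * Y f := by gcongr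
  have h3 : b' * Z f ≤ b * Z f := by gcongr
  have haY : a * Y f ≠ ∞ := ENNReal.mul_ne_top ha hY
  have hbZ : b * Z f ≠ ∞ := ENNReal.mul_ne_top hb hZ
  constructor
  · refine le_antisymm ha' ((ENNReal.mul_le_mul_iff_left hY0 hY).1 ?_)
    exact (ENNReal.add_le_add_iff_right hbZ).1 (h1.trans (by gcongr))
  · refine le_antisymm hb' ((ENNReal.mul_le_mul_iff_left hZ0 hZ).1 ?_)
    exact (ENNReal.add_le_add_iff_left haY).1 (h1.trans (by gcongr))

lemma sharpMultiplicative_of_eq {α : ℝ} (hα0 : 0 ≤ α) (hα1 : α ≤ 1) {c : ℝ≥0∞}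
    (hle : ∀ f ∈ 𝓕, X f ≤ c * Z f ^ (1 - α) * Y f ^ α) {f : V}
    (hf : f ∈ 𝓕) (heq : X f = c * Z f ^ (1 - α) * Y f ^ α) (hY0 : Y f ≠ 0)
    (hY : Y f ≠ ∞) (hZ0 : Z f ≠ 0) (hZ : Z f ≠ ∞) : SharpMultiplicative 𝓕 X Y Z α c := by
  refine ⟨hle, fun c' h => ?_⟩
  have h1 := h f hf
  rw [heq, mul_assoc, mul_assoc] at h1
  refine (ENNReal.mul_le_mul_iff_left (mul_ne_zero ?_ ?_) (ENNReal.mul_ne_top ?_ ?_)).1 h1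
  · exact (ENNReal.rpow_pos (pos_iff_ne_zero.2 hZ0) hZ).ne'
  · exact (ENNReal.rpow_pos (pos_iff_ne_zero.2 hY0) hY).ne'
  · exact ENNReal.rpow_ne_top_of_nonneg (sub_nonneg.2 hα1) hZ
  · exact ENNReal.rpow_ne_top_of_nonneg hα0 hY

end Sharpness

/-! ### Membership in the function classes -/

lemma gradNorm_lt_top (hK : IsNormBody K) {f : E d → ℝ}
    (hf : MemW (C : Set (E d)) p f) : gradNorm K C p f < ∞ := by
  obtain ⟨r, hr, R, hR, hb⟩ := hK.exists_dualNorm_bounds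
  have hG := isWeakGradient_weakGradient hf.2.1
  have h1 : MemLp (fun x => ∑ i, ‖weakGradient (C : Set (E d)) f x i‖) p
      (volume.restrict (C : Set (E d))) := memLp_finsetSum _ fun i _ => (hf.2.2 i).norm
  refine (h1.of_le_mul (c := R) ?_ (ae_of_all _ fun x => ?_)).2
  · exact (hK.continuous_dualNorm.measurable.comp_aemeasurable hG.aemeasurable).aestronglyMeasurable
  · rw [Real.norm_of_nonneg (hK.dualNorm_nonneg _),
      Real.norm_of_nonneg (Finset.sum_nonneg fun i _ => norm_nonneg _)]
    refine (hb _).2.trans (mul_le_mul_of_nonneg_left ?_ hR.le)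
    set z := weakGradient (C : Set (E d)) f x
    have h2 : z = ∑ i, z i • EuclideanSpace.single i (1 : ℝ) := by
      conv_lhs => rw [← (EuclideanSpace.basisFun (Fin d) ℝ).sum_repr z]
      simp
    calc ‖z‖ = ‖∑ i, z i • EuclideanSpace.single i (1 : ℝ)‖ := by rw [← h2]
      _ ≤ ∑ i, ‖z i • EuclideanSpace.single i (1 : ℝ)‖ := norm_sum_le _ _
      _ = ∑ i, ‖z i‖ := Finset.sum_congr rfl fun i _ => by rw [norm_smul]; simp

lemma gEnergy_pos (hd : 1 ≤ d) (hK : IsNormBody K) (hCo : IsOpen (C : Set (E d)))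
    (hCn : (C : Set (E d)).Nonempty) (hp : (d : ℝ≥0∞) < p) (hh : 0 < h) :
    0 < gEnergy K C p h := by
  have hv := vol_pos hK hCo hCn
  have hd0 : (0 : ℝ) < d := by exact_mod_cast hd
  have hc1 := one_le_conjR (one_lt_of_dim_lt hd hp)
  have hB := ProbabilityTheory.beta_pos (beta_arg_pos hd hp) (show 0 < conjR p + 1 by linarith)
  rw [gEnergy_eq hd hK hCo hCn hp hh, ENNReal.ofReal_pos]
  positivity

lemma gEnergy_ne_top (hd : 1 ≤ d) (hK : IsNormBody K) (hCo : IsOpen (C : Set (E d)))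
    (hCn : (C : Set (E d)).Nonempty) (hp : (d : ℝ≥0∞) < p) (hh : 0 < h) :
    gEnergy K C p h ≠ ∞ := by
  rw [gEnergy_eq hd hK hCo hCn hp hh]
  exact ENNReal.ofReal_ne_top

lemma memW_extremal (hd : 1 ≤ d) (hK : IsNormBody K) (hCo : IsOpen (C : Set (E d)))
    (hCn : (C : Set (E d)).Nonempty) (hp : (d : ℝ≥0∞) < p) (hh : 0 < h) :
    MemW (C : Set (E d)) p (extremal K C p h) := by
  have hex : ∃ G, IsWeakGradient (C : Set (E d)) (extremal K (C : Set (E d)) p h) G :=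
    ⟨_, isWeakGradient_extremal hd hK hp hh⟩
  have hG := isWeakGradient_weakGradient hex
  refine ⟨(continuous_extremal hd hK hp hh).locallyIntegrable.locallyIntegrableOn _, hex,
    fun i => ?_⟩
  obtain ⟨r, hr, R, hR, hb⟩ := hK.exists_dualNorm_bounds
  have h1 : MemLp (fun x => dualNorm K (weakGradient (C : Set (E d)) (extremal K C p h) x)) p
      (volume.restrict (C : Set (E d))) := by
    refine ⟨(hK.continuous_dualNorm.measurable.comp_aemeasurable
      hG.aemeasurable).aestronglyMeasurable, ?_⟩
    change gradNorm K C p (extremal K C p h) < ∞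
    rw [gradNorm_extremal hd hK hCo hCn hp hh]
    exact ENNReal.rpow_lt_top_of_nonneg (inv_nonneg.2 ENNReal.toReal_nonneg)
      (gEnergy_ne_top hd hK hCo hCn hp hh)
  refine h1.of_le_mul (c := r⁻¹) (hG.1 i).aestronglyMeasurable (ae_of_all _ fun x => ?_)
  rw [Real.norm_of_nonneg (hK.dualNorm_nonneg _), ← div_eq_inv_mul, le_div_iff₀' hr]
  exact (mul_le_mul_of_nonneg_left (PiLp.norm_apply_le _ i) hr.le).trans (hb _).1

lemma oneNorm_extremal_ne_top (hd : 1 ≤ d) (hK : IsNormBody K) (hCo : IsOpen (C : Set (E d)))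
    (hCn : (C : Set (E d)).Nonempty) (hp : (d : ℝ≥0∞) < p) (hh : 0 < h) :
    oneNorm C (extremal K C p h) ≠ ∞ := by
  have h1 := ofReal_mul_profileMass hd hK hCo hCn hp hh
  have h2 := ENNReal.mul_ne_top (ENNReal.ofReal_ne_top (r := h ^ d * vol K C))
    (profileMass_lt_top (K := K) (C := C) hd hp hh).ne
  rw [h1] at h2
  exact (ENNReal.add_ne_top.1 h2).1

lemma oneNorm_extremal_ne_zero (hd : 1 ≤ d) (hK : IsNormBody K) (hCo : IsOpen (C : Set (E d)))
    (hCn : (C : Set (E d)).Nonempty) (hp : (d : ℝ≥0∞) < p) (hh : 0 < h) :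
    oneNorm C (extremal K C p h) ≠ 0 := by
  have hv := vol_pos hK hCo hCn
  intro h0
  rw [oneNorm, eLpNorm_eq_zero_iff
    (continuous_extremal hd hK hp hh).aestronglyMeasurable one_ne_zero] at h0
  have h1 : supNorm C (extremal K C p h) = 0 := by
    rw [supNorm, eLpNorm_congr_ae h0, eLpNorm_zero]
  rw [supNorm_extremal hd hK hCo hCn hp hh, profileMass,
    lintegral_eq_zero_iff (measurable_profile _ _ _ _).ennreal_ofReal, Filter.EventuallyEq,
    ae_restrict_iff' measurableSet_Ioo, ae_iff] at h1
  have h2 : volume (Ioo 0 h) ≤ 0 := by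
    rw [← h1]
    refine measure_mono fun u hu h' => ?_
    have := h' hu
    simp only [Pi.zero_apply, ENNReal.ofReal_eq_zero] at this
    exact this.not_gt (profile_pos hd hv hh hu)
  rw [Real.volume_Ioo, sub_zero, nonpos_iff_eq_zero, ENNReal.ofReal_eq_zero] at h2
  linarith

lemma gradNorm_extremal_ne_zero (hd : 1 ≤ d) (hK : IsNormBody K) (hCo : IsOpen (C : Set (E d)))
    (hCn : (C : Set (E d)).Nonempty) (hp : (d : ℝ≥0∞) < p) (hh : 0 < h) :
    gradNorm K C p (extremal K C p h) ≠ 0 := by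
  rw [gradNorm_extremal hd hK hCo hCn hp hh]
  exact (ENNReal.rpow_pos (gEnergy_pos hd hK hCo hCn hp hh)
    (gEnergy_ne_top hd hK hCo hCn hp hh)).ne'

/-! ### Equality for the extremal function -/

lemma supNorm_extremal_eq_add (hd : 1 ≤ d) (hK : IsNormBody K) (hCo : IsOpen (C : Set (E d)))
    (hCn : (C : Set (E d)).Nonempty) (hp : (d : ℝ≥0∞) < p) (hh : 0 < h) :
    supNorm C (extremal K C p h) = gNorm K C p h * gradNorm K C p (extremal K C p h) +
      avgConst K C h * oneNorm C (extremal K C p h) := by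
  have hv := vol_pos hK hCo hCn
  have hp1 := one_lt_of_dim_lt hd hp
  have hV0 : ENNReal.ofReal (h ^ d * vol K C) ≠ 0 := by
    rw [Ne, ENNReal.ofReal_eq_zero, not_le]; positivity
  have hVt : ENNReal.ofReal (h ^ d * vol K C) ≠ ∞ := ENNReal.ofReal_ne_top
  have hprod : gNorm K C p h * gradNorm K C p (extremal K C p h) = gEnergy K C p h := by
    rw [gNorm_eq hd hK hCo hp1 hh, gradNorm_extremal hd hK hCo hCn hp hh,
      ← ENNReal.rpow_add _ _ (gEnergy_pos hd hK hCo hCn hp hh).ne'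
        (gEnergy_ne_top hd hK hCo hCn hp hh), add_comm, inv_add_inv_conjR hp1, ENNReal.rpow_one]
  rw [supNorm_extremal hd hK hCo hCn hp hh, hprod, avgConst_eq hK hCo hCn hh,
    ← ENNReal.mul_right_inj hV0 hVt, ofReal_mul_profileMass hd hK hCo hCn hp hh, mul_add,
    ← mul_assoc _ _⁻¹, ENNReal.mul_inv_cancel hV0 hVt, one_mul, add_comm]

lemma supNorm_extremal_eq_mul (hd : 1 ≤ d) (hK : IsNormBody K) (hCo : IsOpen (C : Set (E d)))
    (hCn : (C : Set (E d)).Nonempty) (hp : (d : ℝ≥0∞) < p) (hh : 0 < h) :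
    supNorm C (extremal K C p h) =
      multConst K C p * oneNorm C (extremal K C p h) ^ (1 - alpha d p) *
        gradNorm K C p (extremal K C p h) ^ alpha d p := by
  have hW := memW_extremal (K := K) (C := C) hd hK hCo hCn hp hh
  have hY := (gradNorm_lt_top hK hW).ne
  have hZ := oneNorm_extremal_ne_top hd hK hCo hCn hp hh
  refine le_antisymm (le_multiplicative_bound hd hK hCo hCn hp hY hZ fun t ht => ?_) ?_
  · refine (supNorm_le_gNorm_mul_add hd hK hCo hCn (one_lt_of_dim_lt hd hp).le hW ht).trans ?_
    gcongr
    exact seminormAt_le_oneNorm K hCo t _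
  · rw [supNorm_extremal_eq_add hd hK hCo hCn hp hh]
    have h1 := multiplicative_bound_le hd hK hCo hCn hp
      (ENNReal.toReal_pos (gradNorm_extremal_ne_zero hd hK hCo hCn hp hh) hY)
      (ENNReal.toReal_pos (oneNorm_extremal_ne_zero hd hK hCo hCn hp hh) hZ) hh
    rwa [ENNReal.ofReal_toReal hY, ENNReal.ofReal_toReal hZ] at h1

end NagyInequality

open NagyInequality in
theorem theorem2 (d : ℕ) (hd : 1 ≤ d)
    (K : Set (E d)) (hKo : IsOpen K) (hKc : Convex ℝ K) (hKb : Bornology.IsBounded K)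
    (hKs : ∀ x ∈ K, -x ∈ K) (hK0 : (0 : E d) ∈ K)
    (C : ConvexCone ℝ (E d)) (hCo : IsOpen (C : Set (E d))) (hCn : (C : Set (E d)).Nonempty)
    (p : ℝ≥0∞) (hp : (d : ℝ≥0∞) < p) :
    -- for each `h > 0`: boundedness, the sharp additive inequality, equality for `f_{e,h}`
    (∀ h : ℝ, 0 < h →
      (∀ f ∈ classAt K C p h, MemLp f ∞ (volume.restrict (C : Set (E d)))) ∧
      SharpAdditive (classAt K C p h) (supNorm C) (gradNorm K C p) (seminormAt K C h)
        (gNorm K C p h) (avgConst K C h) ∧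
      extremal K C p h ∈ classAt K C p h ∧
      supNorm C (extremal K C p h) =
        gNorm K C p h * gradNorm K C p (extremal K C p h) +
          avgConst K C h * seminormAt K C h (extremal K C p h)) ∧
    -- the sharp multiplicative inequality, equality for every `f_{e,h}`
    SharpMultiplicative (classSup K C p) (supNorm C) (gradNorm K C p) (seminormSup K C)
      (alpha d p) (multConst K C p) ∧
    (∀ h : ℝ, 0 < h →
      extremal K C p h ∈ classSup K C p ∧
      supNorm C (extremal K C p h) =
        multConst K C p * seminormSup K C (extremal K C p h) ^ (1 - alpha d p) *
          gradNorm K C p (extremal K C p h) ^ alpha d p) ∧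
    -- both inequalities with the `L_1`-norm in place of the seminorms
    (∀ h : ℝ, 0 < h →
      SharpAdditive (classL1 (C : Set (E d)) p) (supNorm C) (gradNorm K C p) (oneNorm C)
        (gNorm K C p h) (avgConst K C h) ∧
      extremal K C p h ∈ classL1 (C : Set (E d)) p ∧
      supNorm C (extremal K C p h) =
        gNorm K C p h * gradNorm K C p (extremal K C p h) +
          avgConst K C h * oneNorm C (extremal K C p h)) ∧
    SharpMultiplicative (classL1 (C : Set (E d)) p) (supNorm C) (gradNorm K C p) (oneNorm C)
      (alpha d p) (multConst K C p) ∧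
    (∀ h : ℝ, 0 < h →
      supNorm C (extremal K C p h) =
        multConst K C p * oneNorm C (extremal K C p h) ^ (1 - alpha d p) *
          gradNorm K C p (extremal K C p h) ^ alpha d p) := by
  have hK : IsNormBody K := ⟨hKo, hKc, hKb, hKs, hK0⟩
  have hp1 := one_lt_of_dim_lt hd hp
  have hα0 := (alpha_pos hd hp).le
  have hα1 := (alpha_lt_one hd hp).le
  have ha : ∀ h : ℝ, 0 < h → gNorm K C p h ≠ ∞ := fun h hh => by
    rw [gNorm_eq_ofReal hd hK hCo hCn hp hh]; exact ENNReal.ofReal_ne_top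
  have hb : ∀ h : ℝ, avgConst K C h ≠ ∞ := fun h => ENNReal.ofReal_ne_top
  have hadd : ∀ {h : ℝ}, 0 < h → ∀ {f}, MemW (C : Set (E d)) p f → supNorm C f ≤
      gNorm K C p h * gradNorm K C p f + avgConst K C h * seminormAt K C h f :=
    fun hh _ hf => supNorm_le_gNorm_mul_add hd hK hCo hCn hp1.le hf hh
  have hadd1 : ∀ {h : ℝ}, 0 < h → ∀ {f}, MemW (C : Set (E d)) p f → supNorm C f ≤
      gNorm K C p h * gradNorm K C p f + avgConst K C h * oneNorm C f :=
    fun hh f hf => (hadd hh hf).trans (by gcongr; exact seminormAt_le_oneNorm K hCo _ f)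
  have hW : ∀ {h : ℝ}, 0 < h → MemW (C : Set (E d)) p (extremal K C p h) :=
    fun hh => memW_extremal hd hK hCo hCn hp hh
  have hY0 : ∀ {h : ℝ}, 0 < h → gradNorm K C p (extremal K C p h) ≠ 0 :=
    fun hh => gradNorm_extremal_ne_zero hd hK hCo hCn hp hh
  have hY : ∀ {h : ℝ}, 0 < h → gradNorm K C p (extremal K C p h) ≠ ∞ :=
    fun hh => (gradNorm_lt_top hK (hW hh)).ne
  have hZ0 : ∀ {h : ℝ}, 0 < h → oneNorm C (extremal K C p h) ≠ 0 :=
    fun hh => oneNorm_extremal_ne_zero hd hK hCo hCn hp hh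
  have hZ : ∀ {h : ℝ}, 0 < h → oneNorm C (extremal K C p h) ≠ ∞ :=
    fun hh => oneNorm_extremal_ne_top hd hK hCo hCn hp hh
  have hat : ∀ {h : ℝ}, 0 < h → seminormAt K C h (extremal K C p h) =
      oneNorm C (extremal K C p h) := fun hh => seminormAt_extremal hd hK hCo hCn hp hh
  have hsup : ∀ {h : ℝ}, 0 < h → seminormSup K C (extremal K C p h) =
      oneNorm C (extremal K C p h) := fun hh => seminormSup_extremal hd hK hCo hCn hp hh
  have heq : ∀ {h : ℝ}, 0 < h → _ := fun hh => supNorm_extremal_eq_add hd hK hCo hCn hp hh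
  have heqm : ∀ {h : ℝ}, 0 < h → _ := fun hh => supNorm_extremal_eq_mul hd hK hCo hCn hp hh
  have hmemAt : ∀ {h : ℝ}, 0 < h → extremal K C p h ∈ classAt K C p h :=
    fun hh => ⟨hW hh, by rw [hat hh]; exact (hZ hh).lt_top⟩
  have hmemSup : ∀ {h : ℝ}, 0 < h → extremal K C p h ∈ classSup K C p :=
    fun hh => ⟨hW hh, by rw [hsup hh]; exact (hZ hh).lt_top⟩
  have hmemL1 : ∀ {h : ℝ}, 0 < h → extremal K C p h ∈ classL1 (C : Set (E d)) p := fun hh =>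
    ⟨hW hh, (continuous_extremal hd hK hp hh).aestronglyMeasurable, (hZ hh).lt_top⟩
  have heqAt : ∀ {h : ℝ}, 0 < h → supNorm C (extremal K C p h) =
      gNorm K C p h * gradNorm K C p (extremal K C p h) +
        avgConst K C h * seminormAt K C h (extremal K C p h) := fun hh => by
    rw [hat hh]; exact heq hh
  have heqSup : ∀ {h : ℝ}, 0 < h → supNorm C (extremal K C p h) =
      multConst K C p * seminormSup K C (extremal K C p h) ^ (1 - alpha d p) *
        gradNorm K C p (extremal K C p h) ^ alpha d p := fun hh => by
    rw [hsup hh]; exact heqm hh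
  refine ⟨fun h hh => ⟨fun f hf => ⟨hf.1.1.aestronglyMeasurable, ?_⟩, ?_, hmemAt hh, heqAt hh⟩, ?_,
    fun h hh => ⟨hmemSup hh, heqSup hh⟩, fun h hh => ⟨?_, hmemL1 hh, heq hh⟩, ?_,
    fun h hh => heqm hh⟩
  · exact (hadd hh hf.1).trans_lt (ENNReal.add_lt_top.2
      ⟨ENNReal.mul_lt_top (ha h hh).lt_top (gradNorm_lt_top hK hf.1),
        ENNReal.mul_lt_top (hb h).lt_top hf.2⟩)
  · exact sharpAdditive_of_eq (fun f hf => hadd hh hf.1) (hmemAt hh) (heqAt hh) (ha h hh) (hb h)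
      (hY0 hh) (hY hh) (by rw [hat hh]; exact hZ0 hh) (by rw [hat hh]; exact hZ hh)
  · refine sharpMultiplicative_of_eq hα0 hα1 (fun f hf => ?_) (hmemSup one_pos) (heqSup one_pos)
      (hY0 one_pos) (hY one_pos) (by rw [hsup one_pos]; exact hZ0 one_pos)
      (by rw [hsup one_pos]; exact hZ one_pos)
    refine le_multiplicative_bound hd hK hCo hCn hp (gradNorm_lt_top hK hf.1).ne hf.2.ne
      fun h hh => (hadd hh hf.1).trans ?_
    gcongr
    exact seminormAt_le_seminormSup K C hh f
  · exact sharpAdditive_of_eq (fun f hf => hadd1 hh hf.1) (hmemL1 hh) (heq hh) (ha h hh) (hb h)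
      (hY0 hh) (hY hh) (hZ0 hh) (hZ hh)
  · exact sharpMultiplicative_of_eq hα0 hα1 (fun f hf => le_multiplicative_bound hd hK hCo hCn hp
      (gradNorm_lt_top hK hf.1).ne hf.2.2.ne fun h hh => hadd1 hh hf.1) (hmemL1 one_pos)
      (heqm one_pos) (hY0 one_pos) (hY one_pos) (hZ0 one_pos) (hZ one_pos)
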